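/- Let $[n]=\{1,\dots,n\}$ be cyclically ordered. For a family $\mathcal I\subseteq\binom{[n]}{2}$ let $S_+(\mathcal I)\subseteq \mathrm{Gr}(2,n)$ be the set of two-dimensional subspaces of $\mathbb R^n$ that are the row space of a real $2\times n$ matrix $A$ whose minor in the columns $i<j$ is positive if $\{i,j\}\in\mathcal I$ and zero if $\{i,j\}\notin\mathcal I$. Call $\mathcal I$ a positroid if $S_+(\mathcal I)\neq\emptyset$, and let $\dim\mathcal I$ be the dimension of $S_+(\mathcal I)$ as a submanifold of $\mathrm{Gr}(2,n)$. For $\mathcal D\subseteq\binom{[n]}{2}$ put $\mathcal D^c=\binom{[n]}{2}\setminus\mathcal D$ and $T_{\mathcal D}=\{i\in[n]\mid \{i,j\}\in\mathcal D\text{ for all }j\in[n]\setminus\{i\}\}$, and let $G_{\mathcal D}$ be the graph with vertex set $[n]\setminus T_{\mathcal D}$ whose edges are the pairs $\{i,j\}\in\mathcal D$ with $i,j\notin T_{\mathcal D}$. Proposition. Let $\mathcal D\subseteq\binom{[n]}{2}$ be such that $\mathcal D^c$ is a positroid. Then the connected components of $G_{\mathcal D}$ can be cyclically ordered, that is, enumerated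 as $C_1,\dots,C_m$ so that, with $C_{m+1}=C_1$, for every $i\in[m]$ some vertex of $C_i$ is immediately followed, in the cyclic order of $[n]\setminus T_{\mathcal D}$, by a vertex of $C_{i+1}$. For every such enumeration, let $J$ be the set of all $j\in[n]\setminus T_{\mathcal D}$ that lie in a component with more than one vertex, let $C_i\cdot C_{i+1}=\{\{a,b\}\mid a\in V(C_i),\,b\in V(C_{i+1})\}$, and let $\mathcal D+\{j\}=\mathcal D\cup\{\{j,k\}\mid k\in[n]\setminus\{j\}\}$. Then the positroids $\mathcal P\subseteq\mathcal D^c$ with $\dim\mathcal P=\dim(\mathcal D^c)-1$ are exactly the complements $(\mathcal D')^c$ of the sets $\mathcal D'$ of the following two kinds: 1. $\mathcal D'=\mathcal D\cup(C_i\cdot C_{i+1})$ with $i\in[m]$, provided that $m\ge 3$; 2. $\mathcal D'=\mathcal D+\{j\}$ with $j\in J$. -/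

import Mathlib

open scoped ContDiff

namespace LinePositroid

/-- The family of all `2`-subsets of the ground set `[n]`, modelled on `Fin n`. -/
def pairs (n : ℕ) : Set (Finset (Fin n)) := {s | s.card = 2}

/-- The complement `𝒟ᶜ` of `𝒟` inside the family of all `2`-subsets. -/
def pairCompl {n : ℕ} (D : Set (Finset (Fin n))) : Set (Finset (Fin n)) := pairs n \ D

/-! ### The Grassmannian of lines, positroid cells and positroids -/

/-- The real Grassmannian `Gr(2, n)`: the two-dimensional linear subspaces of `ℝⁿ`. -/
abbrev Gr (n : ℕ) : Type :=
  {V : Submodule ℝ (Fin n → ℝ) // Module.finrank ℝ V = 2}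

/-- A `2 × n` matrix, given by its two rows, represents `V` if its rows span `V`. -/
def Represents {n : ℕ} (A : Fin 2 → Fin n → ℝ) (V : Gr n) : Prop :=
  Submodule.span ℝ (Set.range A) = V.1

/-- The submatrix of `A` formed by the columns `i` and `j`, in this order. -/
def cols {n : ℕ} (A : Fin 2 → Fin n → ℝ) (i j : Fin n) : Matrix (Fin 2) (Fin 2) ℝ :=
  (Matrix.of A).submatrix id ![i, j]

/-- The set `S₊(ℐ)` of the points of `Gr(2, n)` with a representing matrix whose maximal minor
in the columns `i < j` is positive if `{i, j} ∈ ℐ` and zero otherwise. -/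
def cell {n : ℕ} (I : Set (Finset (Fin n))) : Set (Gr n) :=
  {V | ∃ A : Fin 2 → Fin n → ℝ, Represents A V ∧
    ∀ i j : Fin n, i < j →
      ({i, j} ∈ I → 0 < (cols A i j).det) ∧ ({i, j} ∉ I → (cols A i j).det = 0)}

/-- A family `ℐ` of `2`-subsets of `[n]` is a positroid (of rank `2`) if `S₊(ℐ)` is nonempty. -/
def IsPositroid {n : ℕ} (I : Set (Finset (Fin n))) : Prop :=
  I ⊆ pairs n ∧ (cell I).Nonempty

/-! ### Dimension -/

/-- `S` is a `d`-dimensional embedded smooth submanifold of the normed space `E`: near each of its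
points it is the image of a smooth map `φ` on an open subset of `ℝᵈ` which has a smooth left
inverse `ψ` on an open subset of `E`. (So `φ` is an immersion and a homeomorphism onto its
image. The empty set is a submanifold of every dimension, a nonempty set of at most one.) -/
def IsSubmanifold {E : Type*} [NormedAddCommGroup E] [NormedSpace ℝ E] (S : Set E) (d : ℕ) :
    Prop :=
  ∀ x ∈ S, ∃ (U : Set E) (V : Set (EuclideanSpace ℝ (Fin d)))
    (φ : EuclideanSpace ℝ (Fin d) → E) (ψ : E → EuclideanSpace ℝ (Fin d)),
    IsOpen U ∧ x ∈ U ∧ IsOpen V ∧ ContDiffOn ℝ ∞ φ V ∧ ContDiffOn ℝ ∞ ψ U ∧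
      φ '' V = S ∩ U ∧ ∀ v ∈ V, ψ (φ v) = v

/-- The part of `S ⊆ Gr(2, n)` in the standard affine chart of the columns `i`, `j`. The points
of that chart are the `V` whose Plücker coordinate at `{i, j}` does not vanish; such a `V` is
identified with its unique representing matrix whose columns `i`, `j` form the identity matrix. -/
def inChart {n : ℕ} (S : Set (Gr n)) (i j : Fin n) : Set (Fin 2 → Fin n → ℝ) :=
  {A | cols A i j = 1 ∧ ∃ V ∈ S, Represents A V}

/-- The set `S ⊆ Gr(2, n)` has dimension `d`: it is nonempty and is a `d`-dimensional
submanifold of the manifold `Gr(2, n)`, that is, it is one in each standard affine chart. -/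
def HasDim {n : ℕ} (S : Set (Gr n)) (d : ℕ) : Prop :=
  S.Nonempty ∧ ∀ i j : Fin n, i < j → IsSubmanifold (inChart S i j) d

/-! ### The graph of a family of dependent pairs -/

/-- The vanishing set `T_𝒟` (the loops): the `i` with `{i, j} ∈ 𝒟` for all `j ≠ i`. -/
def vanishing {n : ℕ} (D : Set (Finset (Fin n))) : Set (Fin n) :=
  {i | ∀ j, j ≠ i → {i, j} ∈ D}

/-- The graph `G_𝒟` on `[n] \ T_𝒟`, whose edges are the pairs of vertices that belong to `𝒟`. -/
def graph {n : ℕ} (D : Set (Finset (Fin n))) : SimpleGraph {i : Fin n // i ∉ vanishing D} where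
  Adj i j := i ≠ j ∧ {i.1, j.1} ∈ D
  symm := ⟨fun i j h => ⟨h.1.symm, by rw [Finset.pair_comm]; exact h.2⟩⟩
  loopless := ⟨fun _ h => h.1 rfl⟩

/-- The vertex set `V(C) ⊆ [n]` of a connected component of `G_𝒟`. -/
def verts {n : ℕ} {D : Set (Finset (Fin n))} (C : (graph D).ConnectedComponent) :
    Set (Fin n) :=
  Subtype.val '' C.supp

/-- Going around the cycle `1, 2, …, n, 1`, starting from `i`, one meets `j` strictly before `k`
(and `i`, `j`, `k` are distinct). -/
def CycBetween {n : ℕ} (i j k : Fin n) : Prop :=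
  (i < j ∧ j < k) ∨ (j < k ∧ k < i) ∨ (k < i ∧ i < j)

/-- `k` is the vertex that follows `j` on the polygon with the cyclically ordered vertex set
`[n] \ T_𝒟`. -/
def Follows {n : ℕ} (D : Set (Finset (Fin n))) (j k : Fin n) : Prop :=
  j ∉ vanishing D ∧ k ∉ vanishing D ∧ j ≠ k ∧ ∀ l, CycBetween j l k → l ∈ vanishing D

/-- An enumeration `C₁, …, C_m` of the components of `G_𝒟` is cyclically ordered if for every `i`
some vertex of `C_i` is followed on the polygon by a vertex of `C_{i+1}`, where `C_{m+1} = C₁`;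
`finRotate m` is the map `i ↦ i + 1` modulo `m`. -/
def CyclicallyOrdered {n m : ℕ} {D : Set (Finset (Fin n))}
    (C : Fin m ≃ (graph D).ConnectedComponent) : Prop :=
  ∀ i, ∃ j ∈ verts (C i), ∃ k ∈ verts (C (finRotate m i)), Follows D j k

/-- The set `C · C'` of the pairs with one element in `V(C)` and the other one in `V(C')`. -/
def join {n : ℕ} {D : Set (Finset (Fin n))} (C C' : (graph D).ConnectedComponent) :
    Set (Finset (Fin n)) :=
  {s | ∃ i ∈ verts C, ∃ j ∈ verts C', s = {i, j}}

/-- The set `𝒟 + T = 𝒟 ∪ {{i, j} | i ∈ T, j ∈ [n] \ {i}}`. -/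
def addLoops {n : ℕ} (D : Set (Finset (Fin n))) (T : Set (Fin n)) : Set (Finset (Fin n)) :=
  D ∪ {s | ∃ i ∈ T, ∃ j, j ≠ i ∧ s = {i, j}}

/-- The set `J` of the vertices that lie in a component with more than one vertex. -/
def nonIsolated {n : ℕ} (D : Set (Finset (Fin n))) : Set (Fin n) :=
  {j | ∃ C : (graph D).ConnectedComponent, j ∈ verts C ∧ 1 < (verts C).ncard}

/-- The family `∂Pos₁(𝒟)` of dependent sets: the sets `𝒟 ∪ (C_i · C_{i+1})`, provided that there
are at least three components (if there are two, this is the set of all pairs, whose complement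
is empty and not a positroid), and the sets `𝒟 + {j}` with `j ∈ J`. -/
def boundaryPos {n m : ℕ} (D : Set (Finset (Fin n)))
    (C : Fin m ≃ (graph D).ConnectedComponent) : Set (Set (Finset (Fin n))) :=
  {D' | 3 ≤ m ∧ ∃ i, D' = D ∪ join (C i) (C (finRotate m i))} ∪
    ⋃ j ∈ nonIsolated D, {addLoops D {j}}

end LinePositroid

/-!
A matrix `A` that represents a point of the cell of `𝒟ᶜ` is a configuration of vectors in the
plane with nonnegative minors (`Realizes A D`). Its zero columns are the loops, and two nonloops
lie in the same component of the graph of `D` if and only if their columns are parallel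
(`Realizes.mk_eq_iff`). The signs of the minors force each parallel class to be an interval in the
cyclic order of the nonloops (`Realizes.not_separated`), so exactly one edge of the polygon leaves
each class. Following these edges around the polygon meets every class, hence the successor map on
the set of classes is a rotation, which is the cyclic enumeration
(`Realizes.exists_cyclicallyOrdered`).

In the chart of two nonparallel columns, a point of the cell is determined by one chosen column in
each of the other classes and by the ratio of every other nonloop column to the chosen column of
its class. These are global coordinates with a smooth inverse, so a cell with `N` nonloops and `m`
classes has dimension `2 (m - 2) + (N - m) = N + m - 4` (`Realizes.hasDim_iff`; the dimension is
unique by comparing ranges of derivatives, `IsSubmanifold.dim_unique`).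

If `D ⊆ D'` are both complements of positroids, then neither `N` nor `m` can increase from `D` to
`D'` (`Realizes.card_comp_le`). Codimension one thus leaves two cases. Either there is one new loop
and the number of classes is unchanged, so the loop comes from a class with several elements
(`Realizes.eq_addLoops`); or the loops are the same and exactly two classes merge. In the latter
case these classes are consecutive, since otherwise two edges of the polygon would leave the merged
class (`Realizes.eq_merge`). Conversely, one may replace a column by zero (`Realizes.zeroCol`), or
turn all columns of a class into the direction of the preceding class (`Realizes.turn`): no column
lies between the two, so the signs of the other minors do not change.
-/

namespace LinePositroid

/-! ### Submanifolds of a normed space -/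

section Submanifold

variable {E F : Type*} [NormedAddCommGroup E] [NormedSpace ℝ E]
  [NormedAddCommGroup F] [NormedSpace ℝ F]

/-- A set parametrized in one piece by an open subset of a `d`-dimensional space is a
`d`-dimensional submanifold. -/
theorem isSubmanifold_of_param [FiniteDimensional ℝ F] {d : ℕ} (hd : Module.finrank ℝ F = d)
    {S U : Set E} {φ : F → E} {ψ : E → F} (hU : IsOpen U) (hSU : S ⊆ U)
    (hφ : ContDiff ℝ ∞ φ) (hψ : ContDiffOn ℝ ∞ ψ U)
    (hS : ∀ v, φ v ∈ U → φ v ∈ S) (hr : ∀ x ∈ S, φ (ψ x) = x)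
    (hl : ∀ v, φ v ∈ U → ψ (φ v) = v) : IsSubmanifold S d := by
  intro x hx
  let e : EuclideanSpace ℝ (Fin d) ≃L[ℝ] F :=
    ContinuousLinearEquiv.ofFinrankEq (by simp [hd])
  refine ⟨U, (fun v => φ (e v)) ⁻¹' U, fun v => φ (e v), fun y => e.symm (ψ y), hU, hSU hx,
    hU.preimage (hφ.continuous.comp e.continuous), ?_, ?_, ?_, ?_⟩
  · exact (hφ.comp e.contDiff).contDiffOn
  · exact e.symm.contDiff.comp_contDiffOn hψ
  · ext y
    constructor
    · rintro ⟨v, hv, rfl⟩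
      exact ⟨hS _ hv, hv⟩
    · rintro ⟨hy, hyU⟩
      refine ⟨e.symm (ψ y), ?_, ?_⟩ <;> simp [hr y hy, hyU]
  · intro v hv
    simp [hl _ hv]

/-- If two charts `φ`, `φ'` of the same set meet at a point, then the derivative of `φ` factors
through that of `φ'`, and it is injective, so the dimension of `φ` is at most that of `φ'`. -/
theorem IsSubmanifold.dim_le {S : Set E} {d d' : ℕ} (h : IsSubmanifold S d)
    (h' : IsSubmanifold S d') (hS : S.Nonempty) : d ≤ d' := by
  obtain ⟨x, hx⟩ := hS
  obtain ⟨U, V, φ, ψ, hU, hxU, hV, hφ, hψ, him, hl⟩ := h x hx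
  obtain ⟨U', V', φ', ψ', hU', hxU', hV', hφ', hψ', him', hl'⟩ := h' x hx
  obtain ⟨v, hv, rfl⟩ : x ∈ φ '' V := him ▸ ⟨hx, hxU⟩
  obtain ⟨v', hv', hvv'⟩ : φ v ∈ φ' '' V' := him' ▸ ⟨hx, hxU'⟩
  have dφ : DifferentiableAt ℝ φ v :=
    (hφ.contDiffAt (hV.mem_nhds hv)).differentiableAt (by simp)
  have dψ : DifferentiableAt ℝ ψ (φ v) :=
    (hψ.contDiffAt (hU.mem_nhds hxU)).differentiableAt (by simp)
  have dψ' : DifferentiableAt ℝ ψ' (φ v) :=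
    (hψ'.contDiffAt (hU'.mem_nhds hxU')).differentiableAt (by simp)
  have hv'' : ψ' (φ v) = v' := by rw [← hvv']; exact hl' v' hv'
  have dφ' : DifferentiableAt ℝ φ' (ψ' (φ v)) := by
    rw [hv'']; exact (hφ'.contDiffAt (hV'.mem_nhds hv')).differentiableAt (by simp)
  have near : ∀ᶠ w in nhds v, w ∈ V ∧ φ w ∈ U' :=
    (hV.eventually_mem hv).and (dφ.continuousAt.eventually (hU'.mem_nhds hxU'))
  have e1 : (fun w => ψ (φ' (ψ' (φ w)))) =ᶠ[nhds v] id := by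
    filter_upwards [near] with w hw
    have hw' : φ w ∈ φ' '' V' := by
      rw [him']
      have : φ w ∈ φ '' V := ⟨w, hw.1, rfl⟩
      rw [him] at this
      exact ⟨this.1, hw.2⟩
    obtain ⟨u, hu, hu'⟩ := hw'
    have : φ' (ψ' (φ w)) = φ w := by rw [← hu', hl' u hu]
    simp only [this, hl w hw.1, id]
  have e0 : φ' (ψ' (φ v)) = φ v := by rw [hv'', hvv']
  have dψ0 : DifferentiableAt ℝ ψ (φ' (ψ' (φ v))) := by rwa [e0]
  have key := e1.fderiv_eq (𝕜 := ℝ)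
  have c1 : HasFDerivAt (fun w => ψ' (φ w)) _ v := dψ'.hasFDerivAt.comp v dφ.hasFDerivAt
  have c2 : HasFDerivAt (fun w => φ' (ψ' (φ w))) _ v :=
    HasFDerivAt.comp v dφ'.hasFDerivAt c1
  have c3 : HasFDerivAt (fun w => ψ (φ' (ψ' (φ w)))) _ v :=
    HasFDerivAt.comp v dψ0.hasFDerivAt c2
  rw [c3.fderiv, fderiv_id] at key
  have inj : Function.Injective ((fderiv ℝ ψ' (φ v)).comp (fderiv ℝ φ v)) := by
    intro a b hab
    have ha := congrArg (fun L => L a) key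
    have hb := congrArg (fun L => L b) key
    simp only [ContinuousLinearMap.comp_apply, ContinuousLinearMap.id_apply] at ha hb hab
    rw [← ha, ← hb, hab]
  simpa using LinearMap.finrank_le_finrank_of_injective
    (f := ((fderiv ℝ ψ' (φ v)).comp (fderiv ℝ φ v)).toLinearMap) inj

theorem IsSubmanifold.dim_unique {S : Set E} {d d' : ℕ} (h : IsSubmanifold S d)
    (h' : IsSubmanifold S d') (hS : S.Nonempty) : d = d' :=
  (h.dim_le h' hS).antisymm (h'.dim_le h hS)

end Submanifold

/-! ### Realizations by column vectors -/

section Realization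

variable {n : ℕ} {D : Set (Finset (Fin n))} {A : Fin 2 → Fin n → ℝ}

/-- The minor of `A` in the columns `i`, `j`, written out. -/
def minor (A : Fin 2 → Fin n → ℝ) (i j : Fin n) : ℝ := A 0 i * A 1 j - A 0 j * A 1 i

theorem det_cols (A : Fin 2 → Fin n → ℝ) (i j : Fin n) : (cols A i j).det = minor A i j := by
  simp [cols, minor, Matrix.det_fin_two]

theorem minor_self (A : Fin 2 → Fin n → ℝ) (i : Fin n) : minor A i i = 0 := by
  simp [minor]

theorem minor_swap (A : Fin 2 → Fin n → ℝ) (i j : Fin n) : minor A j i = -minor A i j := by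
  simp only [minor]; ring

theorem minor_comm_eq_zero : minor A i j = 0 ↔ minor A j i = 0 := by
  rw [minor_swap A i j, neg_eq_zero]

/-- The rows of a matrix with a nonvanishing minor are linearly independent. -/
theorem finrank_span_rows {i j : Fin n} (h : minor A i j ≠ 0) :
    Module.finrank ℝ (Submodule.span ℝ (Set.range A)) = 2 := by
  have hli : LinearIndependent ℝ A := by
    rw [Fintype.linearIndependent_iff]
    intro g hg
    have e1 : g 0 * A 0 i + g 1 * A 1 i = 0 := by
      simpa [Fin.sum_univ_two] using congrFun hg i
    have e2 : g 0 * A 0 j + g 1 * A 1 j = 0 := by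
      simpa [Fin.sum_univ_two] using congrFun hg j
    have h0 : g 0 * minor A i j = 0 := by
      simp only [minor]; linear_combination A 1 j * e1 - A 1 i * e2
    have h1 : g 1 * minor A i j = 0 := by
      simp only [minor]; linear_combination A 0 i * e2 - A 0 j * e1
    intro k
    fin_cases k
    · exact (mul_eq_zero.1 h0).resolve_right h
    · exact (mul_eq_zero.1 h1).resolve_right h
  simpa using finrank_span_eq_card hli

theorem exists_minor_ne_zero (h : Module.finrank ℝ (Submodule.span ℝ (Set.range A)) = 2) :
    ∃ i j, minor A i j ≠ 0 := by
  by_contra! h0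
  have hli : LinearIndependent ℝ A := by
    rw [linearIndependent_iff_card_eq_finrank_span]
    simpa [Set.finrank] using h.symm
  rw [Fintype.linearIndependent_iff] at hli
  have hz : ∀ i, A 0 i = 0 := by
    intro i
    have := hli ![A 1 i, -A 0 i] (by
      ext j
      have := h0 i j
      simp only [minor] at this
      simp [Fin.sum_univ_two]
      linarith) 1
    simpa using this
  have := hli ![1, 0] (by ext j; simp [Fin.sum_univ_two, hz]) 0
  simp at this

/-- The columns of `A` form a totally nonnegative configuration of vectors in the plane whose
dependent pairs are those in `D`, and which spans the plane. -/
structure Realizes (A : Fin 2 → Fin n → ℝ) (D : Set (Finset (Fin n))) : Prop where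
  pos : ∀ {i j}, i < j → {i, j} ∉ D → 0 < minor A i j
  zero : ∀ {i j}, i < j → {i, j} ∈ D → minor A i j = 0
  exists_notMem : ∃ i j, i ≠ j ∧ {i, j} ∉ D

theorem pair_mem_pairCompl {i j : Fin n} (h : i ≠ j) : {i, j} ∈ pairCompl D ↔ {i, j} ∉ D := by
  simp [pairCompl, pairs, Finset.card_pair h]

theorem pairCompl_pairCompl {P : Set (Finset (Fin n))} (hP : P ⊆ pairs n) :
    pairCompl (pairCompl P) = P := by
  simp [pairCompl, hP]

theorem Realizes.mem_cell (hA : Realizes A D) {V : Gr n} (hV : Represents A V) :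
    V ∈ cell (pairCompl D) := by
  refine ⟨A, hV, fun i j hij => ⟨fun h => ?_, fun h => ?_⟩⟩
  · rw [det_cols]; exact hA.pos hij ((pair_mem_pairCompl hij.ne).1 h)
  · rw [det_cols]
    exact hA.zero hij (not_not.1 fun h' => h ((pair_mem_pairCompl hij.ne).2 h'))

theorem exists_realizes_of_mem_cell {V : Gr n} (h : V ∈ cell (pairCompl D)) :
    ∃ A, Represents A V ∧ Realizes A D := by
  obtain ⟨A, hV, hA⟩ := h
  have pos : ∀ {i j}, i < j → {i, j} ∉ D → 0 < minor A i j := fun {i j} hij h => by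
    rw [← det_cols]
    exact (hA i j hij).1 ((pair_mem_pairCompl hij.ne).2 h)
  have zero : ∀ {i j}, i < j → {i, j} ∈ D → minor A i j = 0 := fun {i j} hij h => by
    rw [← det_cols]
    exact (hA i j hij).2 fun h' => (pair_mem_pairCompl hij.ne).1 h' h
  refine ⟨A, hV, pos, zero, ?_⟩
  obtain ⟨i, j, hij⟩ := exists_minor_ne_zero (A := A) (by rw [hV]; exact V.2)
  have hne : i ≠ j := by rintro rfl; exact hij (minor_self A i)
  refine ⟨i, j, hne, fun h => hij ?_⟩
  rcases hne.lt_or_gt with h' | h'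
  · exact zero h' h
  · exact minor_comm_eq_zero.1 (zero h' (by rwa [Finset.pair_comm]))

theorem Realizes.mem_iff (hA : Realizes A D) {i j : Fin n} (hij : i ≠ j) :
    {i, j} ∈ D ↔ minor A i j = 0 := by
  rcases hij.lt_or_gt with h | h
  · exact ⟨hA.zero h, fun h0 => by_contra fun h' => (hA.pos h h').ne' h0⟩
  · rw [Finset.pair_comm, ← minor_comm_eq_zero]
    exact ⟨hA.zero h, fun h0 => by_contra fun h' => (hA.pos h h').ne' h0⟩

theorem Realizes.nonneg (hA : Realizes A D) {i j : Fin n} (hij : i < j) : 0 ≤ minor A i j := by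
  by_cases h : {i, j} ∈ D
  · exact (hA.zero hij h).ge
  · exact (hA.pos hij h).le

theorem Realizes.pos' (hA : Realizes A D) {i j : Fin n} (hij : i < j) (h : minor A i j ≠ 0) :
    0 < minor A i j :=
  (hA.nonneg hij).lt_of_ne' h

theorem Realizes.exists_minor_ne (hA : Realizes A D) : ∃ i j, minor A i j ≠ 0 := by
  obtain ⟨i, j, hij, h⟩ := hA.exists_notMem
  exact ⟨i, j, fun h0 => h ((hA.mem_iff hij).2 h0)⟩

theorem isPositroid_pairCompl_iff : IsPositroid (pairCompl D) ↔ ∃ A, Realizes A D := by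
  constructor
  · rintro ⟨-, V, hV⟩
    exact (exists_realizes_of_mem_cell hV).imp fun A h => h.2
  · rintro ⟨A, hA⟩
    obtain ⟨i, j, h⟩ := hA.exists_minor_ne
    exact ⟨Set.sdiff_subset, ⟨_, finrank_span_rows h⟩, hA.mem_cell rfl⟩

theorem Realizes.mem_vanishing_iff (hA : Realizes A D) {i : Fin n} :
    i ∈ vanishing D ↔ ∀ j, minor A i j = 0 := by
  constructor
  · intro h j
    by_cases hij : j = i
    · rw [hij, minor_self]
    · exact (hA.mem_iff (Ne.symm hij)).1 (h j hij)
  · intro h j hij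
    exact (hA.mem_iff (Ne.symm hij)).2 (h j)

theorem Realizes.notMem_vanishing (hA : Realizes A D) {i j : Fin n} (h : minor A i j ≠ 0) :
    i ∉ vanishing D := fun h' => h (hA.mem_vanishing_iff.1 h' j)

theorem Realizes.notMem_vanishing' (hA : Realizes A D) {i j : Fin n} (h : minor A i j ≠ 0) :
    j ∉ vanishing D := hA.notMem_vanishing fun h' => h (minor_comm_eq_zero.1 h')

/-- A vector of the plane which is dependent on both members of a basis is zero. -/
theorem Realizes.col_eq_zero (hA : Realizes A D) {i : Fin n} (hi : i ∈ vanishing D) (a : Fin 2) :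
    A a i = 0 := by
  obtain ⟨j, k, hjk⟩ := hA.exists_minor_ne
  have h1 := hA.mem_vanishing_iff.1 hi j
  have h2 := hA.mem_vanishing_iff.1 hi k
  have e : ∀ a : Fin 2, A a i * minor A j k = A a k * -minor A i j + A a j * minor A i k := by
    intro a
    fin_cases a <;> simp [minor] <;> ring
  have := e a
  rw [h1, h2] at this
  simpa [hjk] using this

/-- The three-term Plücker relation. -/
theorem plucker (A : Fin 2 → Fin n → ℝ) (i j k l : Fin n) :
    minor A i j * minor A k l = minor A i k * minor A j l - minor A i l * minor A j k := by
  simp only [minor]; ring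

theorem Realizes.minor_trans (hA : Realizes A D) {i j k : Fin n} (hj : j ∉ vanishing D)
    (hij : minor A i j = 0) (hjk : minor A j k = 0) : minor A i k = 0 := by
  have : ∃ l, minor A j l ≠ 0 := by
    by_contra! h
    exact hj (hA.mem_vanishing_iff.2 h)
  obtain ⟨l, hl⟩ := this
  have := plucker A i j k l
  rw [hij, hjk] at this
  simpa [hl] using this.symm

/-- Two vertices lie in the same component if and only if their columns are parallel. -/
theorem Realizes.mk_eq_iff (hA : Realizes A D) {i j : {i : Fin n // i ∉ vanishing D}} :
    (graph D).connectedComponentMk i = (graph D).connectedComponentMk j ↔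
      minor A i.1 j.1 = 0 := by
  rw [SimpleGraph.ConnectedComponent.eq]
  constructor
  · rintro ⟨w⟩
    induction w with
    | nil => exact minor_self A _
    | @cons u v w h p ih =>
      refine hA.minor_trans v.2 ((hA.mem_iff ?_).1 h.2) ih
      exact fun e => h.1 (Subtype.ext e)
  · intro h
    by_cases hij : i = j
    · rw [hij]
    · exact SimpleGraph.Adj.reachable
        ⟨hij, (hA.mem_iff fun e => hij (Subtype.ext e)).2 h⟩

theorem Realizes.exists_mk_ne (hA : Realizes A D) : ∃ i j : {i : Fin n // i ∉ vanishing D},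
    (graph D).connectedComponentMk i ≠ (graph D).connectedComponentMk j := by
  obtain ⟨i, j, h⟩ := hA.exists_minor_ne
  exact ⟨⟨i, hA.notMem_vanishing h⟩, ⟨j, hA.notMem_vanishing' h⟩, fun e => h (hA.mk_eq_iff.1 e)⟩

/-- Two parallel columns are not separated, in the cyclic order, by columns which are not
parallel to them: classes of parallel columns are cyclic intervals. -/
theorem Realizes.not_separated (hA : Realizes A D) {i j k l : Fin n} (hij : minor A i j = 0)
    (hj : j ∉ vanishing D) (hi : i ∉ vanishing D)
    (hk : minor A i k ≠ 0) (hl : minor A i l ≠ 0) (hik : CycBetween i k j)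
    (hil : CycBetween j l i) : False := by
  wlog h : i < j generalizing i j k l
  · have hji := minor_comm_eq_zero.1 hij
    have hne : i ≠ j := by
      rintro rfl
      rcases hik with h | h | h <;> order
    exact this hji hi hj (fun e => hl (hA.minor_trans hj hij e))
      (fun e => hk (hA.minor_trans hj hij e)) hil hik (lt_of_le_of_ne (not_lt.1 h) hne.symm)
  have hk' : minor A j k ≠ 0 := fun e => hk (hA.minor_trans hj hij e)
  have hl' : minor A j l ≠ 0 := fun e => hl (hA.minor_trans hj hij e)
  have p := plucker A i j k l
  rw [hij, zero_mul] at p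
  have h1 : i < k ∧ k < j := by
    rcases hik with h | h | h
    · exact h
    · order
    · order
  have e1 := hA.pos' h1.1 hk
  have e2 := hA.pos' h1.2 fun e => hk' (minor_comm_eq_zero.1 e)
  rw [minor_swap] at e2
  have h2 : l < i ∨ j < l := by
    rcases hil with h | h | h
    · order
    · exact Or.inl h.1
    · exact Or.inr h.2
  rcases h2 with h2 | h2
  · have e3 := hA.pos' h2 fun e => hl (minor_comm_eq_zero.1 e)
    have e4 := hA.pos' (h2.trans h) fun e => hl' (minor_comm_eq_zero.1 e)
    rw [minor_swap] at e3 e4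
    nlinarith [mul_pos e1 e4, mul_pos e3 e2]
  · have e3 := hA.pos' (h.trans h2) hl
    have e4 := hA.pos' h2 hl'
    nlinarith [mul_pos e1 e4, mul_pos e3 e2]

/-- At most one edge of the polygon leaves a class of parallel columns. -/
theorem Realizes.leaving_unique (hA : Realizes A D) {j k j' k' : Fin n}
    (hjj' : minor A j j' = 0) (hf : Follows D j k) (hf' : Follows D j' k')
    (hk : minor A j k ≠ 0) (hk' : minor A j' k' ≠ 0) : j = j' := by
  by_contra hne
  have hj := hf.1
  have hj' := hf'.1
  have hk2 : minor A j k' ≠ 0 := fun e => hk' (hA.minor_trans hj (minor_comm_eq_zero.1 hjj') e)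
  have aux : ∀ {a b c : Fin n}, a ≠ b → a ≠ c → b ≠ c → ¬ CycBetween a c b → CycBetween a b c := by
    intro a b c h1 h2 h3 h
    simp only [CycBetween] at h ⊢
    grind
  refine hA.not_separated hjj' hj' hj hk hk2 ?_ ?_
  · have hkj : k ≠ j' := by rintro rfl; exact hk hjj'
    exact aux hf.2.2.1 hne hkj fun h => hj' (hf.2.2.2 _ h)
  · have hkj : k' ≠ j := by rintro rfl; exact hk2 (minor_self A _)
    exact aux hf'.2.2.1 (Ne.symm hne) hkj fun h => hj (hf'.2.2.2 _ h)

end Realization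

/-! ### The dimension of a positroid cell -/

section Dimension

variable {n : ℕ} {D : Set (Finset (Fin n))} {A : Fin 2 → Fin n → ℝ}

/-- The nonloops: the vertices of the polygon, and of the graph of `D`. -/
abbrev Vertex (D : Set (Finset (Fin n))) : Type := {i : Fin n // i ∉ vanishing D}

/-- The connected components of the graph of `D`; for a positroid, the parallel classes. -/
abbrev Comp (D : Set (Finset (Fin n))) : Type := (graph D).ConnectedComponent

noncomputable instance : Fintype (Comp D) := Fintype.ofFinite _

/-- The component of a vertex. -/
abbrev comp (k : Vertex D) : Comp D := (graph D).connectedComponentMk k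

/-- In the chart of two columns with positive minor, the points of a cell are the normalized
matrices which realize the positroid themselves, as the change of basis has positive
determinant. -/
theorem mem_inChart_iff {i j : Fin n} :
    A ∈ inChart (cell (pairCompl D)) i j ∧ i < j ↔
      cols A i j = 1 ∧ Realizes A D ∧ i < j := by
  constructor
  · rintro ⟨⟨h1, V, hV, hAV⟩, hij⟩
    refine ⟨h1, ?_, hij⟩
    obtain ⟨B, hBV, hB⟩ := exists_realizes_of_mem_cell hV
    have hmem : ∀ a, ∃ c : Fin 2 → ℝ, ∑ b, c b • A b = B a := fun a => by
      rw [← Submodule.mem_span_range_iff_exists_fun, hAV, ← hBV]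
      exact Submodule.subset_span ⟨a, rfl⟩
    choose g hg using hmem
    have hB' : ∀ a k, B a k = g a 0 * A 0 k + g a 1 * A 1 k := fun a k => by
      rw [← hg a]; simp [Fin.sum_univ_two]
    set δ : ℝ := g 0 0 * g 1 1 - g 0 1 * g 1 0
    have hδ : ∀ k l, minor B k l = δ * minor A k l := fun k l => by
      simp only [minor, hB', δ]; ring
    have hA1 : minor A i j = 1 := by rw [← det_cols, h1, Matrix.det_one]
    have hδ0 : δ ≠ 0 := by
      obtain ⟨k, l, h⟩ := hB.exists_minor_ne
      exact fun h0 => h (by rw [hδ, h0, zero_mul])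
    have hpos : 0 < δ := by
      have := hB.nonneg hij
      rw [hδ, hA1, mul_one] at this
      exact this.lt_of_ne' hδ0
    refine ⟨fun {k l} hkl h => ?_, fun {k l} hkl h => ?_, hB.exists_notMem⟩
    · have := hB.pos hkl h
      rw [hδ] at this
      exact pos_of_mul_pos_right this hpos.le
    · have := hB.zero hkl h
      rw [hδ] at this
      exact (mul_eq_zero.1 this).resolve_left hδ0
  · rintro ⟨h1, hA, hij⟩
    have hA1 : minor A i j ≠ 0 := by
      rw [← det_cols, h1, Matrix.det_one]; exact one_ne_zero
    exact ⟨⟨h1, ⟨_, finrank_span_rows hA1⟩, hA.mem_cell rfl, rfl⟩, hij⟩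

variable (r : Comp D → Vertex D) (ci cj : Comp D)

/-- The coordinates on a cell in the chart of two columns in the classes `ci` and `cj`, where
`r` chooses a column in each class: the columns chosen in the other classes, and the ratios of
the other columns to the chosen ones. -/
abbrev Param : Type :=
  ({c : Comp D // c ≠ ci ∧ c ≠ cj} → Fin 2 → ℝ) × ({k : Vertex D // r (comp k) ≠ k} → ℝ)

theorem finrank_param (hr : ∀ c, comp (r c) = c) (hc : ci ≠ cj) :
    Module.finrank ℝ (Param r ci cj) + 4 = Nat.card (Vertex D) + Nat.card (Comp D) := by
  classical
  have h1 : Fintype.card {c : Comp D // c ≠ ci ∧ c ≠ cj} + 2 = Fintype.card (Comp D) := by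
    have e := Fintype.card_subtype_compl (fun c : Comp D => c = ci ∨ c = cj)
    have e2 : Fintype.card {c : Comp D // c = ci ∨ c = cj} = 2 := by
      rw [Fintype.card_subtype, ← Finset.card_pair hc]
      congr 1
      ext c; simp
    have e3 := Fintype.card_subtype_le (fun c : Comp D => c = ci ∨ c = cj)
    simp only [not_or] at e
    rw [e]
    omega
  have h2 : Fintype.card {k : Vertex D // r (comp k) ≠ k} + Fintype.card (Comp D) =
      Fintype.card (Vertex D) := by
    have e : Fintype.card {k : Vertex D // r (comp k) = k} = Fintype.card (Comp D) :=
      Fintype.card_congr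
        ⟨fun k => comp k.1, fun c => ⟨r c, by rw [hr]⟩, fun k => Subtype.ext k.2, hr⟩
    have e2 := Fintype.card_subtype_compl (fun k : Vertex D => r (comp k) = k)
    have e3 := Fintype.card_subtype_le (fun k : Vertex D => r (comp k) = k)
    simp only [ne_eq]
    omega
  simp only [Module.finrank_prod, Module.finrank_pi_fintype, Module.finrank_self,
    Finset.sum_const, Finset.card_univ, smul_eq_mul, Fintype.card_fin, mul_one,
    Nat.card_eq_fintype_card]
  omega

open Classical in
/-- The chosen column of each class; in the classes of the chart it is a standard vector. -/
noncomputable def chosenCol (w : {c : Comp D // c ≠ ci ∧ c ≠ cj} → Fin 2 → ℝ) (c : Comp D)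
    (a : Fin 2) : ℝ :=
  if hi : c = ci then ![1, 0] a else if hj : c = cj then ![0, 1] a else w ⟨c, hi, hj⟩ a

open Classical in
/-- The ratio of a column to the chosen column in its class. -/
noncomputable def ratio (t : {k : Vertex D // r (comp k) ≠ k} → ℝ) (k : Vertex D) : ℝ :=
  if h : r (comp k) = k then 1 else t ⟨k, h⟩

open Classical in
/-- The matrix with given coordinates. -/
noncomputable def ofParam (p : Param r ci cj) (a : Fin 2) (k : Fin n) : ℝ :=
  if h : k ∉ vanishing D then ratio r p.2 ⟨k, h⟩ * chosenCol ci cj p.1 (comp ⟨k, h⟩) a else 0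

/-- The coordinates of a matrix; the ratio of two parallel vectors is computed by means of the
standard inner product. -/
noncomputable def toParam (A : Fin 2 → Fin n → ℝ) : Param r ci cj :=
  (fun c a => A a (r c.1), fun k =>
    (A 0 k.1 * A 0 (r (comp k.1)) + A 1 k.1 * A 1 (r (comp k.1))) /
      (A 0 (r (comp k.1)) ^ 2 + A 1 (r (comp k.1)) ^ 2))

/-- The matrices whose minors outside `D` are positive. -/
def positiveOn (D : Set (Finset (Fin n))) : Set (Fin 2 → Fin n → ℝ) :=
  {A | ∀ k l, k < l → {k, l} ∉ D → 0 < minor A k l}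

theorem isOpen_positiveOn : IsOpen (positiveOn D) := by
  simp only [positiveOn, Set.ofPred_forall]
  refine isOpen_iInter_of_finite fun k => isOpen_iInter_of_finite fun l =>
    isOpen_iInter_of_finite fun _ => isOpen_iInter_of_finite fun _ =>
      isOpen_lt continuous_const ?_
  unfold minor
  fun_prop

theorem sq_add_sq_ne_zero_of_positiveOn (hA : A ∈ positiveOn D) (k : Vertex D) :
    A 0 k.1 ^ 2 + A 1 k.1 ^ 2 ≠ 0 := by
  intro h
  have h0 : A 0 k.1 = 0 := by nlinarith [sq_nonneg (A 0 k.1), sq_nonneg (A 1 k.1)]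
  have h1 : A 1 k.1 = 0 := by nlinarith [sq_nonneg (A 0 k.1), sq_nonneg (A 1 k.1)]
  apply k.2
  intro l hl
  by_contra hD
  rcases hl.lt_or_gt with h' | h'
  · rw [Finset.pair_comm] at hD
    have := hA _ _ h' hD
    simp [minor, h0, h1] at this
  · have := hA _ _ h' hD
    simp [minor, h0, h1] at this

open Classical in
theorem contDiff_ofParam : ContDiff ℝ ∞ (ofParam r ci cj) := by
  rw [contDiff_pi]; intro a
  rw [contDiff_pi]; intro k
  unfold ofParam
  by_cases h : k ∈ vanishing D
  · simp only [h, not_true_eq_false, dite_false]; exact contDiff_const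
  · simp only [h, not_false_eq_true, dite_true]
    apply ContDiff.mul
    · unfold ratio; split_ifs <;> fun_prop
    · unfold chosenCol; split_ifs <;> fun_prop

open Classical in
theorem contDiffOn_toParam : ContDiffOn ℝ ∞ (toParam r ci cj) (positiveOn D) := by
  unfold toParam
  apply ContDiffOn.prodMk
  · fun_prop
  · rw [contDiffOn_pi]; intro k
    apply ContDiffOn.div
    · fun_prop
    · fun_prop
    · intro A hA
      exact sq_add_sq_ne_zero_of_positiveOn hA _

variable {r ci cj}

theorem ofParam_vertex (p : Param r ci cj) (a : Fin 2) (k : Vertex D) :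
    ofParam r ci cj p a k.1 = ratio r p.2 k * chosenCol ci cj p.1 (comp k) a := by
  simp [ofParam, k.2]

theorem ofParam_chosen (hr : ∀ c, comp (r c) = c) (p : Param r ci cj) (a : Fin 2) (c : Comp D) :
    ofParam r ci cj p a (r c).1 = chosenCol ci cj p.1 c a := by
  rw [ofParam_vertex, hr]
  simp [ratio, hr]

theorem toParam_ofParam (hr : ∀ c, comp (r c) = c) (p : Param r ci cj)
    (hp : ofParam r ci cj p ∈ positiveOn D) : toParam r ci cj (ofParam r ci cj p) = p := by
  refine Prod.ext ?_ ?_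
  · ext c a
    simp [toParam, ofParam_chosen hr, chosenCol, c.2.1, c.2.2]
  · ext k
    have h0 := sq_add_sq_ne_zero_of_positiveOn hp (r (comp k.1))
    simp only [toParam]
    rw [div_eq_iff h0]
    simp only [ofParam_chosen hr, ofParam_vertex, ratio, k.2, dite_false]
    ring

theorem realizes_ofParam (hD : ∃ i j, i ≠ j ∧ {i, j} ∉ D) (p : Param r ci cj)
    (hp : ofParam r ci cj p ∈ positiveOn D) : Realizes (ofParam r ci cj p) D := by
  refine ⟨fun {k l} => hp k l, fun {k l} hkl h => ?_, hD⟩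
  by_cases hk : k ∈ vanishing D
  · simp [minor, ofParam, hk]
  by_cases hl : l ∈ vanishing D
  · simp [minor, ofParam, hl]
  have hc : comp (⟨k, hk⟩ : Vertex D) = comp ⟨l, hl⟩ := by
    rw [SimpleGraph.ConnectedComponent.eq]
    exact SimpleGraph.Adj.reachable ⟨fun e => hkl.ne (congrArg Subtype.val e), h⟩
  have e : ∀ a, ofParam r ci cj p a k = _ := fun a => ofParam_vertex p a ⟨k, hk⟩
  have e' : ∀ a, ofParam r ci cj p a l = _ := fun a => ofParam_vertex p a ⟨l, hl⟩
  simp only [minor, e, e', hc]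
  ring

theorem ofParam_toParam (hr : ∀ c, comp (r c) = c) (hA : Realizes A D)
    (hci : ∀ a, A a (r ci) = ![1, 0] a) (hcj : ∀ a, A a (r cj) = ![0, 1] a) :
    ofParam r ci cj (toParam r ci cj A) = A := by
  have hcol : ∀ c a, chosenCol ci cj (toParam r ci cj A).1 c a = A a (r c) := by
    intro c a
    unfold chosenCol
    split_ifs with h h'
    · rw [h, hci]
    · rw [h', hcj]
    · rfl
  ext a k
  by_cases hk : k ∈ vanishing D
  · simp [ofParam, hk, hA.col_eq_zero hk]
  lift k to Vertex D using hk
  rw [ofParam_vertex, hcol]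
  unfold ratio
  split_ifs with h
  · rw [h, one_mul]
  · have h0 := sq_add_sq_ne_zero_of_positiveOn (fun k l h => hA.pos h) (r (comp k))
    have hm : minor A k.1 (r (comp k)).1 = 0 := hA.mk_eq_iff.1 (hr (comp k)).symm
    simp only [toParam]
    rw [div_mul_eq_mul_div, div_eq_iff h0]
    simp only [minor] at hm
    fin_cases a
    · simp only [Fin.zero_eta]
      linear_combination (-A 1 (r (comp k))) * hm
    · simp only [Fin.mk_one]
      linear_combination A 0 (r (comp k)) * hm

/-- A positroid cell is a submanifold, whose dimension is the number of nonloops plus the number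
of parallel classes minus four. -/
theorem Realizes.hasDim (hA : Realizes A D) {d : ℕ}
    (hd : d + 4 = Nat.card (Vertex D) + Nat.card (Comp D)) :
    HasDim (cell (pairCompl D)) d := by
  refine ⟨(isPositroid_pairCompl_iff.2 ⟨A, hA⟩).2, fun i j hij => ?_⟩
  rcases (inChart (cell (pairCompl D)) i j).eq_empty_or_nonempty with he | ⟨B, hB⟩
  · rw [he]; exact fun x hx => hx.elim
  obtain ⟨h1, hB, -⟩ := mem_inChart_iff.1 ⟨hB, hij⟩
  have hm : minor B i j ≠ 0 := by
    rw [← det_cols, h1, Matrix.det_one]; exact one_ne_zero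
  let i' : Vertex D := ⟨i, hB.notMem_vanishing hm⟩
  let j' : Vertex D := ⟨j, hB.notMem_vanishing' hm⟩
  have hc : comp i' ≠ comp j' := fun e => hm (hB.mk_eq_iff.1 e)
  classical
  obtain ⟨r, hr, hri, hrj⟩ : ∃ r : Comp D → Vertex D, (∀ c, comp (r c) = c) ∧
      r (comp i') = i' ∧ r (comp j') = j' := by
    refine ⟨fun c => if c = comp i' then i' else if c = comp j' then j' else Quot.out c,
      fun c => ?_, by simp, by simp [hc.symm]⟩
    dsimp only
    split_ifs with h h'
    · exact h.symm
    · exact h'.symm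
    · exact Quot.out_eq c
  have hmem : ∀ B, B ∈ inChart (cell (pairCompl D)) i j → Realizes B D ∧
      (∀ a, B a (r (comp i')) = ![1, 0] a) ∧ (∀ a, B a (r (comp j')) = ![0, 1] a) := by
    intro B hB
    obtain ⟨h1, hB, -⟩ := mem_inChart_iff.1 ⟨hB, hij⟩
    refine ⟨hB, fun a => ?_, fun a => ?_⟩
    · rw [hri]
      revert a
      exact Fin.forall_fin_two.2 ⟨by simpa [cols, i'] using congrFun (congrFun h1 0) 0,
        by simpa [cols, i'] using congrFun (congrFun h1 1) 0⟩
    · rw [hrj]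
      revert a
      exact Fin.forall_fin_two.2 ⟨by simpa [cols, j'] using congrFun (congrFun h1 0) 1,
        by simpa [cols, j'] using congrFun (congrFun h1 1) 1⟩
  have hfr := finrank_param r _ _ hr hc
  refine isSubmanifold_of_param (F := Param r (comp i') (comp j')) (by omega)
    isOpen_positiveOn (fun B hB k l h => (hmem B hB).1.pos h)
    (contDiff_ofParam r _ _) (contDiffOn_toParam r _ _) (fun p hp => ?_) (fun B hB => ?_)
    (fun p hp => toParam_ofParam hr p hp)
  · refine (mem_inChart_iff.2 ⟨?_, realizes_ofParam hA.exists_notMem p hp, hij⟩).1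
    have e1 := fun a => ofParam_chosen hr p a (comp i')
    have e2 := fun a => ofParam_chosen hr p a (comp j')
    simp only [hri, hrj] at e1 e2
    simp only [chosenCol, dite_true, hc.symm, dite_false] at e1 e2
    ext a b
    fin_cases a <;> fin_cases b
    · simpa [cols] using e1 0
    · simpa [cols] using e2 0
    · simpa [cols] using e1 1
    · simpa [cols] using e2 1
  · obtain ⟨h, h1, h2⟩ := hmem B hB
    exact ofParam_toParam hr h h1 h2

/-- The dimension of a set that meets some chart is well defined. -/
theorem HasDim.unique {S : Set (Gr n)} {d d' : ℕ} (h : HasDim S d) (h' : HasDim S d')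
    (hS : ∃ i j, i < j ∧ (inChart S i j).Nonempty) : d = d' := by
  obtain ⟨i, j, hij, hne⟩ := hS
  exact (h.2 i j hij).dim_unique (h'.2 i j hij) hne

/-- A matrix with a nonvanishing minor can be normalized to the identity in its columns. -/
theorem Realizes.exists_inChart_nonempty (hA : Realizes A D) :
    ∃ i j, i < j ∧ (inChart (cell (pairCompl D)) i j).Nonempty := by
  obtain ⟨i, j, hij, hm⟩ : ∃ i j, i < j ∧ 0 < minor A i j := by
    obtain ⟨i, j, hij, h⟩ := hA.exists_notMem
    rcases hij.lt_or_gt with h' | h'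
    · exact ⟨i, j, h', hA.pos h' h⟩
    · exact ⟨j, i, h', hA.pos h' (by rwa [Finset.pair_comm])⟩
  refine ⟨i, j, hij, fun a k => ![minor A k j / minor A i j, minor A i k / minor A i j] a,
    (mem_inChart_iff.2 ⟨?_, ?_, hij⟩).1⟩
  · ext a b
    fin_cases a <;> fin_cases b <;> simp [cols, minor_self, hm.ne']
  · have e : ∀ k l, minor (fun a k => ![minor A k j / minor A i j, minor A i k / minor A i j] a)
        k l = minor A k l / minor A i j := by
      intro k l
      have h0 := hm.ne'
      rw [eq_div_iff h0]
      conv_lhs => rw [minor]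
      simp only [Matrix.cons_val_zero, Matrix.cons_val_one]
      field_simp
      simp only [minor]
      ring
    refine ⟨fun h h' => ?_, fun h h' => ?_, hA.exists_notMem⟩
    · rw [e]; exact div_pos (hA.pos h h') hm
    · rw [e, hA.zero h h', zero_div]

theorem Realizes.two_le_card_comp (hA : Realizes A D) : 2 ≤ Nat.card (Comp D) := by
  obtain ⟨i, j, h⟩ := hA.exists_mk_ne
  have : Nontrivial (Comp D) := ⟨_, _, h⟩
  exact Finite.one_lt_card

theorem card_comp_le : Nat.card (Comp D) ≤ Nat.card (Vertex D) :=
  Nat.card_le_card_of_surjective _ Quot.mk_surjective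

theorem Realizes.hasDim_iff (hA : Realizes A D) {d : ℕ} :
    HasDim (cell (pairCompl D)) d ↔ d + 4 = Nat.card (Vertex D) + Nat.card (Comp D) := by
  refine ⟨fun h => ?_, hA.hasDim⟩
  have h1 := hA.two_le_card_comp
  have h2 := card_comp_le (D := D)
  have h3 := hA.hasDim (d := Nat.card (Vertex D) + Nat.card (Comp D) - 4) (by omega)
  have := h.unique h3 hA.exists_inChart_nonempty
  omega

end Dimension

/-! ### The cyclic order of the components -/

section CyclicOrder

/-- A self-map of a finite set all of whose orbits are the whole set is a rotation. -/
theorem exists_equiv_finRotate {α : Type*} [Fintype α] [Nontrivial α] (f : α → α)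
    (h : ∀ x y, ∃ s : ℕ, f^[s] x = y) :
    ∃ C : Fin (Fintype.card α) ≃ α, ∀ i, f (C i) = C (finRotate _ i) := by
  classical
  have hsurj : Function.Surjective f := by
    intro y
    obtain ⟨x, hx⟩ := exists_ne y
    obtain ⟨s, hs⟩ := h x y
    cases s with
    | zero => exact absurd hs hx
    | succ s => exact ⟨f^[s] x, by rw [← hs, Function.iterate_succ_apply']⟩
  have hinj := Finite.injective_iff_surjective.2 hsurj
  have hfix : ∀ x, f x ≠ x := by
    intro x hx
    obtain ⟨y, hy⟩ := exists_ne x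
    obtain ⟨s, hs⟩ := h x y
    rw [Function.iterate_fixed hx] at hs
    exact hy hs.symm
  let g : Fin (Fintype.card α) ≃ α := (Fintype.equivFin α).symm
  let q : Equiv.Perm (Fin (Fintype.card α)) :=
    (g.trans (Equiv.ofBijective f ⟨hinj, hsurj⟩)).trans g.symm
  have hq : ∀ i, g (q i) = f (g i) := fun i => g.apply_symm_apply _
  have hqs : ∀ (s : ℕ) i, g ((q ^ s) i) = f^[s] (g i) := by
    intro s
    induction s with
    | zero => simp
    | succ s ih => intro i; rw [pow_succ', Function.iterate_succ_apply', Equiv.Perm.mul_apply,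
        hq, ih]
  have hq0 : ∀ i, q i ≠ i := fun i e => hfix (g i) (by rw [← hq, e])
  have hcard : 2 ≤ Fintype.card α := Fintype.one_lt_card
  have hcyc : q.IsCycle := by
    refine ⟨⟨0, by omega⟩, hq0 _, fun y _ => ?_⟩
    obtain ⟨s, hs⟩ := h (g ⟨0, by omega⟩) (g y)
    exact ⟨s, g.injective (by rw [zpow_natCast, hqs, hs])⟩
  have hconj : IsConj (finRotate (Fintype.card α)) q := by
    refine (isCycle_finRotate_of_le hcard).isConj hcyc ?_
    rw [support_finRotate_of_le hcard]
    congr 1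
    ext i
    simp [hq0]
  obtain ⟨π, hπ⟩ := isConj_iff.1 hconj
  refine ⟨π.trans g, fun i => ?_⟩
  simp only [Equiv.trans_apply]
  rw [← hq, ← hπ]
  simp

variable {n : ℕ} {D : Set (Finset (Fin n))} {A : Fin 2 → Fin n → ℝ}

theorem Follows.unique {j k k' : Fin n} (h : Follows D j k) (h' : Follows D j k') : k = k' := by
  by_contra hne
  have h1 := mt (h.2.2.2 k') h'.2.1
  have h2 := mt (h'.2.2.2 k) h.2.1
  have h3 := h.2.2.1
  have h4 := h'.2.2.1
  simp only [CycBetween] at h1 h2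
  grind

/-- In the increasing enumeration of the nonloops, each one is followed by the next one modulo
the number of nonloops. -/
theorem follows_finRotate {N : ℕ} (hN : 2 ≤ N) (e : Fin N ≃o Vertex D) (a : Fin N) :
    Follows D (e a).1 (e (finRotate N a)).1 := by
  obtain ⟨M, rfl⟩ : ∃ M, N = M + 2 := ⟨N - 2, by omega⟩
  have hrot := coe_finRotate a
  refine ⟨(e a).2, (e _).2, ?_, fun l hl => ?_⟩
  · intro h
    have h1 := e.injective (Subtype.ext h)
    rw [← h1] at hrot
    split_ifs at hrot with h2
    · rw [h2] at hrot; simp at hrot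
    · omega
  · by_contra hl'
    obtain ⟨c, hc⟩ := e.surjective ⟨l, hl'⟩
    obtain rfl : (e c).1 = l := congrArg Subtype.val hc
    simp only [CycBetween, Subtype.coe_lt_coe, e.lt_iff_lt, Fin.lt_def, hrot] at hl
    have := c.2
    split_ifs at hl with h2
    · rw [h2] at hl; simp at hl; omega
    · omega

/-- The polygon has an edge from a vertex of the component `X` to one of the component `Y`. -/
def Precedes (X Y : Comp D) : Prop :=
  X ≠ Y ∧ ∃ j k : Vertex D, comp j = X ∧ comp k = Y ∧ Follows D j.1 k.1

theorem Realizes.precedes_unique (hA : Realizes A D) {X Y Y' : Comp D} (h : Precedes X Y)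
    (h' : Precedes X Y') : Y = Y' := by
  obtain ⟨h, j, k, rfl, rfl, hf⟩ := h
  obtain ⟨h', j', k', hj, rfl, hf'⟩ := h'
  have e := hA.leaving_unique (hA.mk_eq_iff.1 hj.symm) hf hf' (fun e => h (hA.mk_eq_iff.2 e))
    (fun e => h' (hj.symm.trans (hA.mk_eq_iff.2 e)))
  rw [← e] at hf'
  rw [Subtype.ext (hf.unique hf')]

/-- Going once around the polygon, one meets all components, in the order of the relation
`Precedes`, which is therefore a rotation of the set of components. -/
theorem Realizes.exists_cyclicallyOrdered (hA : Realizes A D) :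
    ∃ (m : ℕ) (C : Fin m ≃ (graph D).ConnectedComponent), CyclicallyOrdered C := by
  classical
  obtain ⟨x, y, hxy⟩ := hA.exists_mk_ne
  have : Nontrivial (Comp D) := ⟨_, _, hxy⟩
  have hN : 2 ≤ Fintype.card (Vertex D) :=
    Fintype.one_lt_card_iff.2 ⟨x, y, fun e => hxy (by rw [e])⟩
  let e := Fintype.orderIsoFinOfCardEq (Vertex D) rfl
  let ρ := finRotate (Fintype.card (Vertex D))
  have hρ : ∀ a b, ∃ t : ℕ, (ρ ^ t) a = b := by
    have hne : ∀ c, ρ c ≠ c := fun c =>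
      Equiv.Perm.mem_support.1 (by rw [support_finRotate_of_le hN]; exact Finset.mem_univ c)
    exact fun a b => (isCycle_finRotate_of_le hN).exists_pow_eq (hne a) (hne b)
  have hex : ∀ X : Comp D, ∃ Y, Precedes X Y := by
    intro X
    by_contra! hX
    obtain ⟨x, rfl⟩ := X.exists_rep
    obtain ⟨a, rfl⟩ := e.surjective x
    have hall : ∀ t : ℕ, comp (e ((ρ ^ t) a)) = comp (e a) := by
      intro t
      induction t with
      | zero => rfl
      | succ t ih =>
        by_contra hne
        refine hX (comp (e ((ρ ^ (t + 1)) a))) ⟨fun h => hne h.symm, _, _, ih, rfl, ?_⟩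
        rw [pow_succ', Equiv.Perm.mul_apply]
        exact follows_finRotate hN e _
    obtain ⟨Y, hY⟩ := exists_ne (comp (e a))
    obtain ⟨y, rfl⟩ := Y.exists_rep
    obtain ⟨b, rfl⟩ := e.surjective y
    obtain ⟨t, rfl⟩ := hρ a b
    exact hY (hall t)
  choose σ hσ using hex
  have hreach : ∀ (t : ℕ) a, ∃ s : ℕ, σ^[s] (comp (e a)) = comp (e ((ρ ^ t) a)) := by
    intro t a
    induction t with
    | zero => exact ⟨0, rfl⟩
    | succ t ih =>
      obtain ⟨s, hs⟩ := ih
      by_cases hne : comp (e ((ρ ^ t) a)) = comp (e ((ρ ^ (t + 1)) a))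
      · exact ⟨s, hs.trans hne⟩
      · refine ⟨s + 1, ?_⟩
        rw [Function.iterate_succ_apply', hs]
        refine hA.precedes_unique (hσ _) ⟨hne, _, _, rfl, rfl, ?_⟩
        rw [pow_succ', Equiv.Perm.mul_apply]
        exact follows_finRotate hN e _
  obtain ⟨C, hC⟩ := exists_equiv_finRotate σ (by
    intro X Y
    obtain ⟨x, rfl⟩ := X.exists_rep
    obtain ⟨a, rfl⟩ := e.surjective x
    obtain ⟨y, rfl⟩ := Y.exists_rep
    obtain ⟨b, rfl⟩ := e.surjective y
    obtain ⟨t, rfl⟩ := hρ a b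
    exact hreach t a)
  refine ⟨_, C, fun i => ?_⟩
  obtain ⟨-, j, k, hj, hk, hf⟩ := hσ (C i)
  exact ⟨j.1, ⟨j, hj, rfl⟩, k.1, ⟨k, hk.trans (hC i), rfl⟩, hf⟩

end CyclicOrder

/-! ### Removing a vertex and merging consecutive classes -/

section Boundary

variable {n : ℕ} {D : Set (Finset (Fin n))} {A : Fin 2 → Fin n → ℝ}

theorem pair_eq_pair {i j k l : Fin n} :
    ({i, j} : Finset (Fin n)) = {k, l} ↔ i = k ∧ j = l ∨ i = l ∧ j = k := by
  rw [← Finset.coe_inj]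
  push_cast
  exact Set.pair_eq_pair_iff

theorem mem_verts {k : Fin n} {C : Comp D} : k ∈ verts C ↔ ∃ h : k ∉ vanishing D, comp ⟨k, h⟩ = C :=
  ⟨fun ⟨x, hx, e⟩ => by subst e; exact ⟨x.2, hx⟩, fun ⟨h, e⟩ => ⟨⟨k, h⟩, e, rfl⟩⟩

theorem Realizes.mem_verts_comp (hA : Realizes A D) {a : Vertex D} {k : Fin n} :
    k ∈ verts (comp a) ↔ k ∉ vanishing D ∧ minor A a.1 k = 0 := by
  rw [mem_verts, ← exists_prop]
  refine exists_congr fun h => ?_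
  rw [hA.mk_eq_iff, minor_comm_eq_zero]

theorem pair_mem_join {X Y : Comp D} {k l : Fin n} :
    {k, l} ∈ join X Y ↔ k ∈ verts X ∧ l ∈ verts Y ∨ l ∈ verts X ∧ k ∈ verts Y := by
  constructor
  · rintro ⟨i, hi, j, hj, h⟩
    rcases pair_eq_pair.1 h with ⟨rfl, rfl⟩ | ⟨rfl, rfl⟩
    · exact Or.inl ⟨hi, hj⟩
    · exact Or.inr ⟨hi, hj⟩
  · rintro (⟨hk, hl⟩ | ⟨hl, hk⟩)
    · exact ⟨k, hk, l, hl, rfl⟩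
    · exact ⟨l, hl, k, hk, Finset.pair_comm _ _⟩

theorem join_comm (X Y : Comp D) : join X Y = join Y X := by
  have h : ∀ X Y : Comp D, join X Y ⊆ join Y X := by
    rintro X Y _ ⟨i, hi, j, hj, rfl⟩
    exact ⟨j, hj, i, hi, Finset.pair_comm _ _⟩
  exact (h X Y).antisymm (h Y X)

theorem pair_mem_addLoops {j k l : Fin n} (hkl : k ≠ l) :
    {k, l} ∈ addLoops D {j} ↔ {k, l} ∈ D ∨ k = j ∨ l = j := by
  simp only [addLoops, Set.mem_union, Set.mem_ofPred_eq, Set.mem_singleton_iff, exists_eq_left]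
  refine or_congr_right ⟨?_, ?_⟩
  · rintro ⟨i, -, h⟩
    rcases pair_eq_pair.1 h with h | h <;> simp [h]
  · rintro (rfl | rfl)
    · exact ⟨l, hkl.symm, rfl⟩
    · exact ⟨k, hkl, Finset.pair_comm _ _⟩

theorem pairCompl_congr {D' : Set (Finset (Fin n))}
    (h : ∀ k l : Fin n, k ≠ l → ({k, l} ∈ D ↔ {k, l} ∈ D')) : pairCompl D = pairCompl D' := by
  ext s
  simp only [pairCompl, Set.mem_sdiff]
  refine and_congr_right fun hs => ?_
  obtain ⟨k, l, hkl, rfl⟩ := Finset.card_eq_two.1 hs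
  exact not_congr (h k l hkl)

theorem pairCompl_subset_pairCompl {D' : Set (Finset (Fin n))} (h : D ⊆ D') :
    pairCompl D' ⊆ pairCompl D := Set.sdiff_subset_sdiff_right h

theorem mem_nonIsolated {j : Fin n} : j ∈ nonIsolated D ↔
    ∃ (h : j ∉ vanishing D) (p : Vertex D), p.1 ≠ j ∧ comp p = comp ⟨j, h⟩ := by
  constructor
  · rintro ⟨C, hj, hC⟩
    obtain ⟨h, rfl⟩ := mem_verts.1 hj
    obtain ⟨p, hp, hne⟩ := Set.exists_ne_of_one_lt_ncard hC j
    obtain ⟨hp', e⟩ := mem_verts.1 hp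
    exact ⟨h, ⟨p, hp'⟩, hne, e⟩
  · rintro ⟨h, p, hne, e⟩
    refine ⟨comp ⟨j, h⟩, mem_verts.2 ⟨h, rfl⟩, ?_⟩
    rw [Set.one_lt_ncard]
    exact ⟨p.1, mem_verts.2 ⟨p.2, e⟩, j, mem_verts.2 ⟨h, rfl⟩, hne⟩

/-- The columns of `A`, with the `j`-th one replaced by zero. -/
noncomputable def zeroCol (A : Fin 2 → Fin n → ℝ) (j : Fin n) (a : Fin 2) : Fin n → ℝ :=
  Function.update (A a) j 0

theorem minor_zeroCol_of_ne {j k l : Fin n} (hk : k ≠ j) (hl : l ≠ j) :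
    minor (zeroCol A j) k l = minor A k l := by
  simp [minor, zeroCol, hk, hl]

theorem minor_zeroCol_left (A : Fin 2 → Fin n → ℝ) (j l : Fin n) :
    minor (zeroCol A j) j l = 0 := by
  simp [minor, zeroCol]

theorem minor_zeroCol_right (A : Fin 2 → Fin n → ℝ) (j l : Fin n) :
    minor (zeroCol A j) l j = 0 := by
  simp [minor, zeroCol]

/-- A class with several elements survives the removal of one of them. -/
theorem Realizes.zeroCol (hA : Realizes A D) {j : Fin n} (hj : j ∈ nonIsolated D) :
    Realizes (zeroCol A j) (addLoops D {j}) := by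
  refine ⟨fun {k l} hkl h => ?_, fun {k l} hkl h => ?_, ?_⟩
  · rw [pair_mem_addLoops hkl.ne] at h
    push Not at h
    rw [minor_zeroCol_of_ne h.2.1 h.2.2]
    exact hA.pos hkl h.1
  · rcases (pair_mem_addLoops hkl.ne).1 h with h | rfl | rfl
    · by_cases hk : k = j
      · rw [hk, minor_zeroCol_left]
      by_cases hl : l = j
      · rw [hl, minor_zeroCol_right]
      rw [minor_zeroCol_of_ne hk hl, hA.zero hkl h]
    · exact minor_zeroCol_left _ _ _
    · exact minor_zeroCol_right _ _ _
  · obtain ⟨hj', p, hp, e⟩ := mem_nonIsolated.1 hj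
    obtain ⟨q, hq⟩ : ∃ q, minor A p.1 q ≠ 0 := by
      by_contra! h
      exact p.2 (hA.mem_vanishing_iff.2 h)
    have hqj : q ≠ j := by rintro rfl; exact hq (hA.mk_eq_iff.1 e)
    have hpq : p.1 ≠ q := by rintro rfl; exact hq (minor_self _ _)
    refine ⟨p.1, q, hpq, ?_⟩
    rw [pair_mem_addLoops hpq, hA.mem_iff hpq]
    simp [hq, hp, hqj]

theorem Realizes.notMem_vanishing_addLoops_iff (hA : Realizes A D) {j : Fin n}
    (hj : j ∈ nonIsolated D) (i : Fin n) :
    i ∉ vanishing (addLoops D {j}) ↔ i ∉ vanishing D ∧ i ≠ j := by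
  have hA' := hA.zeroCol hj
  rw [hA'.mem_vanishing_iff, hA.mem_vanishing_iff]
  push Not
  constructor
  · rintro ⟨k, hk⟩
    have hi : i ≠ j := by rintro rfl; exact hk (minor_zeroCol_left _ _ _)
    have hkj : k ≠ j := by rintro rfl; exact hk (minor_zeroCol_right _ _ _)
    exact ⟨⟨k, by rwa [minor_zeroCol_of_ne hi hkj] at hk⟩, hi⟩
  · rintro ⟨⟨k, hk⟩, hi⟩
    by_cases hkj : k = j
    · subst hkj
      obtain ⟨hk', p, hp, e⟩ := mem_nonIsolated.1 hj
      refine ⟨p.1, ?_⟩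
      rw [minor_zeroCol_of_ne hi hp]
      exact fun h => hk (hA.minor_trans p.2 h (hA.mk_eq_iff.1 e))
    · exact ⟨k, by rwa [minor_zeroCol_of_ne hi hkj]⟩

theorem Realizes.card_vertex_addLoops (hA : Realizes A D) {j : Fin n} (hj : j ∈ nonIsolated D) :
    Nat.card (Vertex (addLoops D {j})) + 1 = Nat.card (Vertex D) := by
  classical
  have hj' : j ∉ vanishing D := (mem_nonIsolated.1 hj).1
  have e : Nat.card (Vertex (addLoops D {j})) = Nat.card {i : Vertex D // i ≠ ⟨j, hj'⟩} := by
    refine Nat.card_congr ⟨fun i => ⟨⟨i.1, ?_⟩, ?_⟩, fun i => ⟨i.1.1, ?_⟩, fun i => rfl, fun i => rfl⟩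
    · exact ((hA.notMem_vanishing_addLoops_iff hj i.1).1 i.2).1
    · exact fun e => ((hA.notMem_vanishing_addLoops_iff hj i.1).1 i.2).2 (congrArg Subtype.val e)
    · exact (hA.notMem_vanishing_addLoops_iff hj _).2 ⟨i.1.2, fun e => i.2 (Subtype.ext e)⟩
  rw [e, Nat.card_eq_fintype_card, Nat.card_eq_fintype_card]
  have := Fintype.card_subtype_compl (fun i : Vertex D => i = ⟨j, hj'⟩)
  rw [Fintype.card_subtype_eq] at this
  have h1 : 0 < Fintype.card (Vertex D) := Fintype.card_pos_iff.2 ⟨⟨j, hj'⟩⟩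
  simp only [ne_eq]
  omega

theorem Realizes.card_comp_addLoops (hA : Realizes A D) {j : Fin n} (hj : j ∈ nonIsolated D) :
    Nat.card (Comp (addLoops D {j})) = Nat.card (Comp D) := by
  have hv := hA.notMem_vanishing_addLoops_iff hj
  let f : graph (addLoops D {j}) →g graph D :=
    { toFun := fun i => ⟨i.1, ((hv i.1).1 i.2).1⟩
      map_rel' := by
        intro i k h
        have hne : i.1 ≠ k.1 := fun e => h.1 (Subtype.ext e)
        refine ⟨fun e => hne (Subtype.mk.inj e), ?_⟩
        have := (pair_mem_addLoops hne).1 h.2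
        simpa [((hv i.1).1 i.2).2, ((hv k.1).1 k.2).2] using this }
  refine Nat.card_eq_of_bijective (SimpleGraph.ConnectedComponent.map f) ⟨?_, ?_⟩
  · intro X Y
    obtain ⟨x, rfl⟩ := X.exists_rep
    obtain ⟨y, rfl⟩ := Y.exists_rep
    intro h
    have h0 : minor A x.1 y.1 = 0 := hA.mk_eq_iff.1 h
    refine (hA.zeroCol hj).mk_eq_iff.2 ?_
    rwa [minor_zeroCol_of_ne ((hv x.1).1 x.2).2 ((hv y.1).1 y.2).2]
  · intro X
    obtain ⟨x, rfl⟩ := X.exists_rep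
    by_cases hx : x.1 = j
    · obtain ⟨hj', p, hp, e⟩ := mem_nonIsolated.1 hj
      refine ⟨comp ⟨p.1, (hv p.1).2 ⟨p.2, hp⟩⟩, e.trans ?_⟩
      exact congrArg comp (Subtype.ext hx.symm)
    · exact ⟨comp ⟨x.1, (hv x.1).2 ⟨x.2, hx⟩⟩, rfl⟩

/-- If two elements of a finite set are identified and nothing else, the cardinality drops by
one. -/
theorem card_add_one_of_identify {α β : Type*} [Finite α] {f : α → β}
    (hf : Function.Surjective f) {x y : α} (hxy : x ≠ y) (he : f x = f y)
    (h : ∀ u v, f u = f v → u = v ∨ u = x ∧ v = y ∨ u = y ∧ v = x) :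
    Nat.card β + 1 = Nat.card α := by
  classical
  have := Fintype.ofFinite α
  have hb : Function.Bijective fun u : {u // u ≠ y} => f u.1 := by
    constructor
    · rintro ⟨u, hu⟩ ⟨v, hv⟩ huv
      rcases h u v huv with h | h | h
      · exact Subtype.ext h
      · exact absurd h.2 hv
      · exact absurd h.1 hu
    · intro b
      obtain ⟨u, rfl⟩ := hf b
      by_cases hu : u = y
      · exact ⟨⟨x, hxy⟩, by rw [hu, ← he]⟩
      · exact ⟨⟨u, hu⟩, rfl⟩
  rw [← Nat.card_eq_of_bijective _ hb, Nat.card_eq_fintype_card, Nat.card_eq_fintype_card]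
  have := Fintype.card_subtype_compl (fun i : α => i = y)
  rw [Fintype.card_subtype_eq] at this
  have h1 : 0 < Fintype.card α := Fintype.card_pos_iff.2 ⟨y⟩
  simp only [ne_eq]
  omega

/-- The converse of `card_add_one_of_identify`. -/
theorem exists_identify_of_card {α β : Type*} [Finite α] {f : α → β}
    (hf : Function.Surjective f) (hcard : Nat.card β + 1 = Nat.card α) :
    ∃ x y, x ≠ y ∧ f x = f y ∧ ∀ u v, f u = f v → u = v ∨ u = x ∧ v = y ∨ u = y ∧ v = x := by
  classical
  have := Fintype.ofFinite α
  have := Finite.of_surjective f hf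
  have := Fintype.ofFinite β
  have hni : ¬ Function.Injective f := fun hi => by
    have := Nat.card_eq_of_bijective f ⟨hi, hf⟩
    omega
  simp only [Function.Injective, not_forall] at hni
  obtain ⟨x, y, he, hxy⟩ := hni
  have hs : Function.Surjective fun u : {u // u ≠ y} => f u.1 := by
    intro b
    obtain ⟨u, rfl⟩ := hf b
    by_cases hu : u = y
    · exact ⟨⟨x, hxy⟩, by rw [hu, ← he]⟩
    · exact ⟨⟨u, hu⟩, rfl⟩
  have hc : Fintype.card {u // u ≠ y} = Fintype.card β := by
    rw [Nat.card_eq_fintype_card, Nat.card_eq_fintype_card] at hcard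
    have := Fintype.card_subtype_compl (fun i : α => i = y)
    rw [Fintype.card_subtype_eq] at this
    simp only [ne_eq]
    omega
  have hi := ((Fintype.bijective_iff_surjective_and_card _).2 ⟨hs, hc⟩).1
  have key : ∀ u v, u ≠ y → v ≠ y → f u = f v → u = v := fun u v hu hv h =>
    congrArg Subtype.val (@hi ⟨u, hu⟩ ⟨v, hv⟩ h)
  refine ⟨x, y, hxy, he, fun u v h => ?_⟩
  by_cases hu : u = y
  · by_cases hv : v = y
    · exact Or.inl (hu.trans hv.symm)
    · exact Or.inr (Or.inr ⟨hu, key v x hv hxy (by rw [← h, hu, he])⟩)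
  · by_cases hv : v = y
    · exact Or.inr (Or.inl ⟨key u x hu hxy (by rw [h, hv, he]), hv⟩)
    · exact Or.inl (key u v hu hv h)

/-- If no loops are added, passing from `D` to a larger set maps the components of the graph of
`D` onto those of the new graph. -/
noncomputable def compMap {D' : Set (Finset (Fin n))} (h : D ⊆ D')
    (hT : vanishing D' ⊆ vanishing D) : Comp D → Comp D' :=
  SimpleGraph.ConnectedComponent.map
    { toFun := fun i => ⟨i.1, fun h' => i.2 (hT h')⟩
      map_rel' := fun hik =>
        ⟨fun e => hik.1 (Subtype.ext (Subtype.mk.inj e)), h hik.2⟩ }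

theorem compMap_comp {D' : Set (Finset (Fin n))} (h : D ⊆ D')
    (hT : vanishing D' ⊆ vanishing D) (x : Vertex D) :
    compMap h hT (comp x) = comp ⟨x.1, fun h' => x.2 (hT h')⟩ := rfl

theorem vanishing_mono {D' : Set (Finset (Fin n))} (h : D ⊆ D') : vanishing D ⊆ vanishing D' :=
  fun _ hi j hj => h (hi j hj)

theorem compMap_surjective {D' : Set (Finset (Fin n))} (h : D ⊆ D')
    (hT : vanishing D' ⊆ vanishing D) : Function.Surjective (compMap h hT) := by
  intro X
  obtain ⟨x, rfl⟩ := X.exists_rep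
  exact ⟨comp ⟨x.1, fun h' => x.2 (vanishing_mono h h')⟩, rfl⟩

open Classical in
/-- The columns of `A`, with those in the class of `b` turned into the direction of column `a`
and rescaled. The sign accounts for the passage from the last to the first vertex of the
polygon, where the direction is reversed. -/
noncomputable def turn (A : Fin 2 → Fin n → ℝ) (a b : Fin n) (x : Fin 2) (k : Fin n) : ℝ :=
  if minor A b k = 0 then
    ((if a < b then 1 else -1) * (minor A k a / minor A b a)) * A x a
  else A x k

/-- The factor by which the minors of a column `l` with columns in the class of `b` change. -/
noncomputable def turnFactor (A : Fin 2 → Fin n → ℝ) (a b l : Fin n) : ℝ :=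
  (if a < b then 1 else -1) * (minor A a l / minor A b l)

theorem minor_turn_of_mem {a b k l : Fin n} (hab : minor A a b ≠ 0) (hk : minor A b k = 0)
    (hl : minor A b l ≠ 0) : minor (turn A a b) k l = turnFactor A a b l * minor A k l := by
  have hba : minor A b a ≠ 0 := fun h => hab (minor_comm_eq_zero.1 h)
  have p : minor A k l * minor A b a = minor A k a * minor A b l := by
    have := plucker A b k l a
    rw [hk, zero_mul] at this
    linarith
  have e : minor (turn A a b) k l =
      ((if a < b then 1 else -1) * (minor A k a / minor A b a)) * minor A a l := by
    conv_lhs => rw [minor]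
    simp only [turn, hk, hl, if_true, if_false]
    simp only [minor]
    ring
  rw [e, turnFactor, (eq_div_iff hba).2 p]
  field_simp

theorem minor_turn_of_notMem {a b k l : Fin n} (hk : minor A b k ≠ 0) (hl : minor A b l ≠ 0) :
    minor (turn A a b) k l = minor A k l := by
  simp [minor, turn] at *
  simp [hk, hl]

theorem minor_turn_of_mem_of_mem {a b k l : Fin n} (hk : minor A b k = 0)
    (hl : minor A b l = 0) : minor (turn A a b) k l = 0 := by
  conv_lhs => rw [minor]
  simp only [turn, hk, hl, if_true]
  ring

/-- When `b` follows `a`, no column separates the two, so the columns in other classes lie on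
the same side of both. -/
theorem Realizes.turnFactor_pos (hA : Realizes A D) {a b l : Fin n} (hf : Follows D a b)
    (ha : minor A a l ≠ 0) (hb : minor A b l ≠ 0) : 0 < turnFactor A a b l := by
  have hl := hA.notMem_vanishing' ha
  have hc := mt (hf.2.2.2 l) hl
  have hne := hf.2.2.1
  have hal : a ≠ l := by rintro rfl; exact ha (minor_self _ _)
  have hbl : b ≠ l := by rintro rfl; exact hb (minor_self _ _)
  have pos : ∀ {i}, i < l → minor A i l ≠ 0 → 0 < minor A i l := fun h h' => hA.pos' h h'
  have neg : ∀ {i}, l < i → minor A i l ≠ 0 → minor A i l < 0 := fun h h' => by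
    have := hA.pos' h fun e => h' (minor_comm_eq_zero.1 e)
    rw [minor_swap] at this
    linarith
  simp only [CycBetween, not_or, not_and, not_lt] at hc
  unfold turnFactor
  rcases hne.lt_or_gt with h | h
  · rw [if_pos h, one_mul]
    rcases hal.lt_or_gt with h1 | h1
    · have h2 : b < l := lt_of_le_of_ne (hc.1 h1) hbl
      exact div_pos (pos h1 ha) (pos h2 hb)
    · exact div_pos_of_neg_of_neg (neg h1 ha) (neg (h1.trans h) hb)
  · rw [if_neg h.not_gt, neg_one_mul, neg_pos]
    have h1 : l < a := lt_of_le_of_ne (not_lt.1 fun h' => absurd (hc.2.2 h) (not_le.2 h')) hal.symm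
    have h2 : b < l := lt_of_le_of_ne (not_lt.1 fun h' => absurd (hc.2.1 h') (not_le.2 h)) hbl
    exact div_neg_of_neg_of_pos (neg h1 ha) (pos h2 hb)

/-- Turning the class of `b` into that of the vertex `a` it follows merges the two classes. -/
theorem Realizes.turn (hA : Realizes A D) {a b c : Vertex D} (hf : Follows D a.1 b.1)
    (hab : comp a ≠ comp b) (hac : comp a ≠ comp c) (hbc : comp b ≠ comp c) :
    Realizes (turn A a.1 b.1) (D ∪ join (comp a) (comp b)) := by
  have hab' : minor A a.1 b.1 ≠ 0 := fun e => hab (hA.mk_eq_iff.2 e)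
  have hac' : minor A a.1 c.1 ≠ 0 := fun e => hac (hA.mk_eq_iff.2 e)
  have hbc' : minor A b.1 c.1 ≠ 0 := fun e => hbc (hA.mk_eq_iff.2 e)
  have hmem : ∀ {k l : Fin n}, k ≠ l → ({k, l} ∈ D ∪ join (comp a) (comp b) ↔
      minor A k l = 0 ∨ (minor A a.1 k = 0 ∧ minor A b.1 l = 0) ∨
        (minor A a.1 l = 0 ∧ minor A b.1 k = 0)) := by
    intro k l hkl
    rw [Set.mem_union, hA.mem_iff hkl, pair_mem_join]
    simp only [hA.mem_verts_comp]
    constructor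
    · tauto
    · intro h
      by_cases hk : k ∈ vanishing D
      · exact Or.inl (hA.mem_vanishing_iff.1 hk l)
      by_cases hl : l ∈ vanishing D
      · exact Or.inl (minor_comm_eq_zero.1 (hA.mem_vanishing_iff.1 hl k))
      tauto
  have hbase : ∀ {k l : Fin n}, minor A b.1 k = 0 → minor A b.1 l = 0 → minor A k l = 0 :=
    fun hk hl => hA.minor_trans b.2 (minor_comm_eq_zero.1 hk) hl
  have hzero : ∀ {l : Fin n}, minor A a.1 l = 0 → turnFactor A a.1 b.1 l = 0 := by
    intro l h
    simp [turnFactor, h]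
  refine ⟨fun {k l} hkl h => ?_, fun {k l} hkl h => ?_, a.1, c.1, ?_, ?_⟩
  · rw [hmem hkl.ne] at h
    push Not at h
    have hp := hA.pos' hkl h.1
    by_cases hk : minor A b.1 k = 0
    · by_cases hl : minor A b.1 l = 0
      · exact absurd (hbase hk hl) h.1
      · rw [minor_turn_of_mem hab' hk hl]
        exact mul_pos (hA.turnFactor_pos hf (fun e => h.2.2 e hk) hl) hp
    · by_cases hl : minor A b.1 l = 0
      · rw [minor_swap, minor_turn_of_mem hab' hl hk, minor_swap A k l, mul_neg, neg_neg]
        exact mul_pos (hA.turnFactor_pos hf (fun e => h.2.1 e hl) hk) hp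
      · rwa [minor_turn_of_notMem hk hl]
  · rw [hmem hkl.ne] at h
    by_cases hk : minor A b.1 k = 0
    · by_cases hl : minor A b.1 l = 0
      · exact minor_turn_of_mem_of_mem hk hl
      · rw [minor_turn_of_mem hab' hk hl]
        rcases h with h | h | h
        · rw [h, mul_zero]
        · exact absurd h.2 hl
        · rw [hzero h.1, zero_mul]
    · by_cases hl : minor A b.1 l = 0
      · rw [minor_swap, minor_turn_of_mem hab' hl hk, minor_swap A k l]
        rcases h with h | h | h
        · rw [h]; simp
        · rw [hzero h.1]; simp
        · exact absurd h.2 hk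
      · rw [minor_turn_of_notMem hk hl]
        rcases h with h | h | h
        · exact h
        · exact absurd h.2 hl
        · exact absurd h.2 hk
  · intro h
    rw [h] at hac'
    exact hac' (minor_self _ _)
  · rw [hmem fun h => by rw [h] at hac'; exact hac' (minor_self _ _)]
    simp [hac', hbc']

end Boundary

/-! ### The boundary of codimension one -/

section Codimension

variable {n : ℕ} {D D' : Set (Finset (Fin n))} {A A' : Fin 2 → Fin n → ℝ}

theorem Realizes.vanishing_merge (hA : Realizes A D) {a b c : Vertex D}
    (hac : comp a ≠ comp c) (hbc : comp b ≠ comp c) :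
    vanishing (D ∪ join (comp a) (comp b)) ⊆ vanishing D := by
  intro i hi
  by_contra hiD
  -- A vertex outside both classes is independent of `a`, one inside is independent of `c`.
  have key : ∀ {j : Vertex D}, comp ⟨i, hiD⟩ ≠ comp j → ({i, j.1} ∈ join (comp a) (comp b)) := by
    intro j hj
    have hne : i ≠ j.1 := by rintro rfl; exact hj rfl
    exact (hi j.1 hne.symm).resolve_left
      fun h => hj (hA.mk_eq_iff.2 ((hA.mem_iff hne).1 h))
  have hv : ∀ {X : Comp D} {j : Vertex D}, j.1 ∈ verts X → comp j = X := fun h =>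
    (mem_verts.1 h).2
  have hv' : ∀ {X : Comp D}, i ∈ verts X → comp ⟨i, hiD⟩ = X := fun h => (mem_verts.1 h).2
  by_cases hc : comp ⟨i, hiD⟩ = comp c
  · rcases pair_mem_join.1 (key (j := a) (by rw [hc]; exact hac.symm)) with h | h
    · exact hac ((hv' h.1).symm.trans hc)
    · exact hbc ((hv' h.2).symm.trans hc)
  · rcases pair_mem_join.1 (key hc) with h | h
    · exact hbc (hv h.2).symm
    · exact hac (hv h.1).symm

theorem card_vertex_congr (h : vanishing D' = vanishing D) :
    Nat.card (Vertex D') = Nat.card (Vertex D) := by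
  rw [Vertex, Vertex, h]

theorem Realizes.card_comp_merge (hA : Realizes A D) {a b c : Vertex D} (hf : Follows D a.1 b.1)
    (hab : comp a ≠ comp b) (hac : comp a ≠ comp c) (hbc : comp b ≠ comp c) :
    Nat.card (Comp (D ∪ join (comp a) (comp b))) + 1 = Nat.card (Comp D) := by
  have hA' := hA.turn hf hab hac hbc
  have hT := hA.vanishing_merge hac hbc
  have hiff : ∀ x y : Vertex D, compMap Set.subset_union_left hT (comp x) =
      compMap Set.subset_union_left hT (comp y) ↔
      x = y ∨ {x.1, y.1} ∈ D ∪ join (comp a) (comp b) := by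
    intro x y
    rw [compMap_comp, compMap_comp, hA'.mk_eq_iff]
    by_cases hxy : x = y
    · simp [hxy, minor_self]
    · rw [← hA'.mem_iff fun e => hxy (Subtype.ext e)]
      simp [hxy]
  refine card_add_one_of_identify (compMap_surjective Set.subset_union_left hT) hab ?_ ?_
  · exact (hiff a b).2 (Or.inr (Or.inr ⟨a.1, mem_verts.2 ⟨a.2, rfl⟩, b.1,
      mem_verts.2 ⟨b.2, rfl⟩, rfl⟩))
  · intro X Y h
    obtain ⟨x, rfl⟩ := X.exists_rep
    obtain ⟨y, rfl⟩ := Y.exists_rep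
    by_cases hxy : x = y
    · rw [hxy]; exact Or.inl rfl
    have hne : x.1 ≠ y.1 := fun e => hxy (Subtype.ext e)
    rcases ((hiff x y).1 h).resolve_left hxy with h | h
    · exact Or.inl (hA.mk_eq_iff.2 ((hA.mem_iff hne).1 h))
    · rcases pair_mem_join.1 h with h | h
      · exact Or.inr (Or.inl ⟨(mem_verts.1 h.1).2, (mem_verts.1 h.2).2⟩)
      · exact Or.inr (Or.inr ⟨(mem_verts.1 h.2).2, (mem_verts.1 h.1).2⟩)

/-- Enlarging `D` to the set of another positroid does not increase the number of components. If
the number stays the same, then each component keeps a vertex, and no two of them are merged. -/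
theorem Realizes.card_comp_le (hA : Realizes A D) (hA' : Realizes A' D') (h : D ⊆ D') :
    Nat.card (Comp D') ≤ Nat.card (Comp D) ∧
      (Nat.card (Comp D') = Nat.card (Comp D) →
        (∀ x : Vertex D, ∃ y : Vertex D', minor A x.1 y.1 = 0) ∧
        ∀ x y : Vertex D', minor A' x.1 y.1 = 0 → minor A x.1 y.1 = 0) := by
  let ι : Vertex D' → Vertex D := fun x => ⟨x.1, fun h' => x.2 (vanishing_mono h h')⟩
  have hle : ∀ x y : Vertex D', minor A x.1 y.1 = 0 → minor A' x.1 y.1 = 0 := by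
    intro x y hxy
    by_cases hne : x.1 = y.1
    · rw [hne, minor_self]
    · exact (hA'.mem_iff hne).1 (h ((hA.mem_iff hne).2 hxy))
  let rep : Comp D' → Vertex D' := Quot.out
  have hrep : ∀ X, comp (rep X) = X := Quot.out_eq
  let g : Comp D' → Comp D := fun X => comp (ι (rep X))
  have hg : Function.Injective g := by
    intro X Y hXY
    rw [← hrep X, ← hrep Y]
    exact hA'.mk_eq_iff.2 (hle _ _ (hA.mk_eq_iff.1 hXY))
  refine ⟨Nat.card_le_card_of_injective g hg, fun hcard => ?_⟩
  have hs : Function.Surjective g :=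
    ((Nat.bijective_iff_injective_and_card g).2 ⟨hg, hcard⟩).2
  refine ⟨fun x => ?_, fun x y hxy => ?_⟩
  · obtain ⟨X, hX⟩ := hs (comp x)
    exact ⟨rep X, minor_comm_eq_zero.1 (hA.mk_eq_iff.1 hX)⟩
  · have key : ∀ x : Vertex D', comp (ι x) = g (comp x) := by
      intro x
      obtain ⟨X, hX⟩ := hs (comp (ι x))
      have : comp (rep X) = comp x := hA'.mk_eq_iff.2 (hle _ _ (hA.mk_eq_iff.1 hX))
      rw [← hX, ← this, hrep]
    exact hA.mk_eq_iff.1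
      ((key x).trans ((congrArg g (hA'.mk_eq_iff.2 hxy)).trans (key y).symm))

/-- A positroid of codimension one with one more loop: its loop is removed from a class with
several elements. -/
theorem Realizes.eq_addLoops (hA : Realizes A D) (hA' : Realizes A' D') (h : D ⊆ D')
    (hv : Nat.card (Vertex D') + 1 = Nat.card (Vertex D))
    (hc : Nat.card (Comp D') = Nat.card (Comp D)) :
    ∃ j ∈ nonIsolated D, pairCompl D' = pairCompl (addLoops D {j}) := by
  classical
  obtain ⟨hrep, hsame⟩ := (hA.card_comp_le hA' h).2 hc
  have hT := vanishing_mono h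
  obtain ⟨j, hj⟩ : ∃ j : Vertex D, ∀ i : Vertex D, i.1 ∈ vanishing D' ↔ i = j := by
    have e : Nat.card {i : Vertex D // i.1 ∉ vanishing D'} = Nat.card (Vertex D') :=
      Nat.card_congr ⟨fun i => ⟨i.1.1, i.2⟩, fun i => ⟨⟨i.1, fun h' => i.2 (hT h')⟩, i.2⟩,
        fun i => rfl, fun i => rfl⟩
    rw [Nat.card_eq_fintype_card] at e
    rw [Nat.card_eq_fintype_card (α := Vertex D)] at hv
    have e2 := Fintype.card_subtype_compl (fun i : Vertex D => i.1 ∈ vanishing D')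
    have e3 := Fintype.card_subtype_le (fun i : Vertex D => i.1 ∈ vanishing D')
    have e4 : Fintype.card {i : Vertex D // i.1 ∈ vanishing D'} = 1 := by omega
    obtain ⟨⟨j, hj⟩, hj'⟩ := Fintype.card_eq_one_iff.1 e4
    exact ⟨j, fun i => ⟨fun hi => congrArg Subtype.val (hj' ⟨i, hi⟩), fun hi => hi ▸ hj⟩⟩
  refine ⟨j.1, ?_, pairCompl_congr fun k l hkl => ?_⟩
  · obtain ⟨y, hy⟩ := hrep j
    refine mem_nonIsolated.2 ⟨j.2, ⟨y.1, fun h' => y.2 (hT h')⟩, fun e => ?_,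
      hA.mk_eq_iff.2 (minor_comm_eq_zero.1 hy)⟩
    exact y.2 (by rw [show y.1 = j.1 from e]; exact (hj j).2 rfl)
  · rw [pair_mem_addLoops hkl]
    constructor
    · intro hm
      by_contra! hn
      have hm0 := (hA'.mem_iff hkl).1 hm
      have hn0 := mt (hA.mem_iff hkl).2 hn.1
      have hk := hA.notMem_vanishing hn0
      have hl := hA.notMem_vanishing' hn0
      refine hn0 (hsame ⟨k, fun h' => ?_⟩ ⟨l, fun h' => ?_⟩ hm0)
      · exact hn.2.1 (congrArg Subtype.val ((hj ⟨k, hk⟩).1 h'))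
      · exact hn.2.2 (congrArg Subtype.val ((hj ⟨l, hl⟩).1 h'))
    · have hj0 := (hj j).2 rfl
      rintro (hm | rfl | rfl)
      · exact h hm
      · exact hj0 l hkl.symm
      · rw [Finset.pair_comm]
        exact hj0 k hkl

theorem finRotate_ne {m : ℕ} (hm : 2 ≤ m) (i : Fin m) : finRotate m i ≠ i :=
  Equiv.Perm.mem_support.1 (by rw [support_finRotate_of_le hm]; exact Finset.mem_univ i)

/-- A positroid of codimension one with the same loops arises by merging two classes. As only one
edge of the polygon leaves the merged class, these two are consecutive. -/
theorem Realizes.eq_merge (hA : Realizes A D) (hA' : Realizes A' D') (h : D ⊆ D')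
    (hv : Nat.card (Vertex D') = Nat.card (Vertex D))
    (hc : Nat.card (Comp D') + 1 = Nat.card (Comp D)) {m : ℕ} {C : Fin m ≃ Comp D}
    (hC : CyclicallyOrdered C) :
    ∃ i, pairCompl D' = pairCompl (D ∪ join (C i) (C (finRotate m i))) := by
  classical
  have hT : vanishing D' = vanishing D := by
    have hsub := vanishing_mono h
    have e : Nat.card ((vanishing D')ᶜ : Set (Fin n)) = Nat.card ((vanishing D)ᶜ : Set (Fin n)) :=
      hv
    rw [Nat.card_coe_set_eq, Nat.card_coe_set_eq] at e
    exact compl_injective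
      (Set.eq_of_subset_of_ncard_le (Set.compl_subset_compl.2 hsub) e.ge (Set.toFinite _))
  obtain ⟨X, Y, hXY, he, hid⟩ := exists_identify_of_card (compMap_surjective h hT.subset) hc
  have hm : 2 ≤ m := by
    have := hA.two_le_card_comp
    rwa [← Nat.card_congr C, Nat.card_fin] at this
  -- The family `D'` differs from `D` by the pairs in `X · Y`.
  have hD' : ∀ k l : Fin n, k ≠ l → ({k, l} ∈ D' ↔ {k, l} ∈ D ∪ join X Y) := by
    intro k l hkl
    by_cases hk : k ∈ vanishing D
    · exact iff_of_true (h (hk l hkl.symm)) (Or.inl (hk l hkl.symm))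
    by_cases hl : l ∈ vanishing D
    · rw [Finset.pair_comm]
      exact iff_of_true (h (hl k hkl)) (Or.inl (hl k hkl))
    have e1 : {k, l} ∈ D' ↔ compMap h hT.subset (comp ⟨k, hk⟩) =
        compMap h hT.subset (comp ⟨l, hl⟩) := by
      rw [compMap_comp, compMap_comp, hA'.mk_eq_iff, hA'.mem_iff hkl]
    have e2 : {k, l} ∈ D ↔ comp (⟨k, hk⟩ : Vertex D) = comp ⟨l, hl⟩ := by
      rw [hA.mk_eq_iff, hA.mem_iff hkl]
    rw [e1, Set.mem_union, e2, pair_mem_join]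
    simp only [mem_verts]
    constructor
    · intro hkl'
      rcases hid _ _ hkl' with h | h | h
      · exact Or.inl h
      · exact Or.inr (Or.inl ⟨⟨hk, h.1⟩, hl, h.2⟩)
      · exact Or.inr (Or.inr ⟨⟨hl, h.2⟩, hk, h.1⟩)
    · rintro (h | ⟨⟨_, h1⟩, _, h2⟩ | ⟨⟨_, h1⟩, _, h2⟩)
      · rw [h]
      · rw [h1, h2, he]
      · rw [h1, h2, he]
  obtain ⟨p, rfl⟩ := C.surjective X
  obtain ⟨q, rfl⟩ := C.surjective Y
  have hpq : finRotate m p = q ∨ finRotate m q = p := by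
    by_contra! hn
    obtain ⟨j, hj, k, hk, hf⟩ := hC p
    obtain ⟨j', hj', k', hk', hf'⟩ := hC q
    obtain ⟨hj, ej⟩ := mem_verts.1 hj
    obtain ⟨hk, ek⟩ := mem_verts.1 hk
    obtain ⟨hj', ej'⟩ := mem_verts.1 hj'
    obtain ⟨hk', ek'⟩ := mem_verts.1 hk'
    have hmin : ∀ {x y : Fin n} (hx : x ∉ vanishing D) (hy : y ∉ vanishing D),
        minor A' x y = 0 ↔ compMap h hT.subset (comp ⟨x, hx⟩) =
          compMap h hT.subset (comp ⟨y, hy⟩) := by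
      intro x y hx hy
      rw [compMap_comp, compMap_comp, hA'.mk_eq_iff]
    have hfol : ∀ {x y : Fin n}, Follows D x y → Follows D' x y := by
      intro x y hxy
      rwa [Follows, hT]
    have hjj := hA'.leaving_unique ((hmin hj hj').2 (by rw [ej, ej', he])) (hfol hf) (hfol hf')
      (fun e => by
        have e' := (hmin hj hk).1 e
        rw [ej, ek] at e'
        rcases hid _ _ e' with h | h | h
        · exact finRotate_ne hm p (C.injective h).symm
        · exact hn.1 (C.injective h.2)
        · exact hXY h.1)
      (fun e => by
        have e' := (hmin hj' hk').1 e
        rw [ej', ek'] at e'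
        rcases hid _ _ e' with h | h | h
        · exact finRotate_ne hm q (C.injective h).symm
        · exact hXY h.1.symm
        · exact hn.2 (C.injective h.2))
    subst hjj
    exact hXY (ej.symm.trans ej')
  rcases hpq with rfl | rfl
  · exact ⟨p, pairCompl_congr hD'⟩
  · exact ⟨q, by rw [join_comm]; exact pairCompl_congr hD'⟩

end Codimension

end LinePositroid

theorem proposition4p3 (n : ℕ) (D : Set (Finset (Fin n))) (hD : D ⊆ LinePositroid.pairs n)
    (hpos : LinePositroid.IsPositroid (LinePositroid.pairCompl D)) :
    (∃ (m : ℕ) (C : Fin m ≃ (LinePositroid.graph D).ConnectedComponent),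
      LinePositroid.CyclicallyOrdered C) ∧
    ∀ (m : ℕ) (C : Fin m ≃ (LinePositroid.graph D).ConnectedComponent),
      LinePositroid.CyclicallyOrdered C →
      {P : Set (Finset (Fin n)) | LinePositroid.IsPositroid P ∧ P ⊆ LinePositroid.pairCompl D ∧
        ∃ d : ℕ, LinePositroid.HasDim (LinePositroid.cell P) d ∧
          LinePositroid.HasDim (LinePositroid.cell (LinePositroid.pairCompl D)) (d + 1)} =
      LinePositroid.pairCompl '' LinePositroid.boundaryPos D C := by
  open LinePositroid in
  obtain ⟨A, hA⟩ := isPositroid_pairCompl_iff.1 hpos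
  refine ⟨hA.exists_cyclicallyOrdered, fun m C hC => ?_⟩
  have hcm : Nat.card (Comp D) = m := by rw [← Nat.card_congr C, Nat.card_fin]
  have hm := hA.two_le_card_comp
  have hmn := card_comp_le (D := D)
  ext P
  constructor
  · rintro ⟨hP, hPD, d, hd, hd1⟩
    obtain ⟨D', rfl, hsub⟩ : ∃ D', P = pairCompl D' ∧ D ⊆ D' :=
      ⟨pairCompl P, (pairCompl_pairCompl hP.1).symm, fun s hs => ⟨hD hs, fun h => (hPD h).2 hs⟩⟩
    obtain ⟨A', hA'⟩ := isPositroid_pairCompl_iff.1 hP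
    rw [hA'.hasDim_iff] at hd
    rw [hA.hasDim_iff] at hd1
    have hv : Nat.card (Vertex D') ≤ Nat.card (Vertex D) :=
      Nat.card_le_card_of_injective
        (fun i => (⟨i.1, fun h => i.2 (vanishing_mono hsub h)⟩ : Vertex D))
        fun i k h => Subtype.ext (Subtype.mk.inj h)
    have hc := (hA.card_comp_le hA' hsub).1
    obtain h | h : Nat.card (Comp D') = Nat.card (Comp D) ∨
        Nat.card (Vertex D') = Nat.card (Vertex D) := by omega
    · obtain ⟨j, hj, e⟩ := hA.eq_addLoops hA' hsub (by omega) h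
      exact ⟨_, Or.inr (Set.mem_biUnion hj rfl), e.symm⟩
    · obtain ⟨i, e⟩ := hA.eq_merge hA' hsub h (by omega) hC
      have := hA'.two_le_card_comp
      exact ⟨_, Or.inl ⟨by omega, i, rfl⟩, e.symm⟩
  · rintro ⟨D', hD' | hD', rfl⟩
    · obtain ⟨hm3, i, rfl⟩ := hD'
      obtain ⟨j, hj, k, hk, hf⟩ := hC i
      obtain ⟨hj, ej⟩ := mem_verts.1 hj
      obtain ⟨hk, ek⟩ := mem_verts.1 hk
      have hne : comp (⟨j, hj⟩ : Vertex D) ≠ comp ⟨k, hk⟩ := by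
        rw [ej, ek]
        exact fun e => finRotate_ne (by omega) i (C.injective e).symm
      obtain ⟨Z, hZ1, hZ2⟩ : ∃ Z : Comp D, Z ≠ C i ∧ Z ≠ C (finRotate m i) := by
        classical
        have h2 : 2 < Nat.card (Comp D) := by omega
        obtain ⟨Z, -, hZ⟩ := Finset.exists_mem_notMem_of_card_lt_card
          (s := {C i, C (finRotate m i)}) (t := Finset.univ) (Finset.card_le_two.trans_lt (by
            rwa [Finset.card_univ, ← Nat.card_eq_fintype_card]))
        exact ⟨Z, by simpa using hZ⟩
      obtain ⟨c, rfl⟩ := Z.exists_rep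
      rw [← ej] at hZ1 ⊢
      rw [← ek] at hZ2 ⊢
      have hA' := hA.turn hf hne hZ1.symm hZ2.symm
      have hc := hA.card_comp_merge hf hne hZ1.symm hZ2.symm
      have hv := card_vertex_congr ((hA.vanishing_merge hZ1.symm hZ2.symm).antisymm
        (vanishing_mono Set.subset_union_left))
      refine ⟨isPositroid_pairCompl_iff.2 ⟨_, hA'⟩,
        pairCompl_subset_pairCompl Set.subset_union_left,
        Nat.card (Vertex D) + Nat.card (Comp D) - 5, hA'.hasDim ?_, hA.hasDim ?_⟩ <;> omega
    · obtain ⟨j, hj, rfl⟩ := Set.mem_iUnion₂.1 hD'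
      have hc := hA.card_comp_addLoops hj
      have hv := hA.card_vertex_addLoops hj
      have := card_comp_le (D := addLoops D {j})
      refine ⟨isPositroid_pairCompl_iff.2 ⟨_, hA.zeroCol hj⟩,
        pairCompl_subset_pairCompl Set.subset_union_left,
        Nat.card (Vertex D) + Nat.card (Comp D) - 5, (hA.zeroCol hj).hasDim ?_,
        hA.hasDim ?_⟩ <;> omega
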